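/- Let $k$ be a field of characteristic $\neq 2$ and let $A=A_+\oplus A_-$ be a super-affine Hopf algebra over $k$: a finitely generated super-commutative $k$-superalgebra with a coassociative, counital comultiplication $m^*:A\to A\otimes^\varepsilon A$ ($\otimes^\varepsilon$ the super tensor product, with the sign rule), counit $e^*:A\to k$ and antipode, all three being (even) homomorphisms of $k$-superalgebras. Let $J$ be the ideal of $A$ generated by $A_-$, $\pi:A\to B=A/J$ the projection, $G=\mathrm{Spec}(B)$, and regard $A$ as a $B$-comodule via $\Delta=(\mathrm{id}\otimes\pi)\circ m^*:A\to A\otimes B$. The powers $J^n$ are subcomodules, so that $J^n/J^{n+1}$ is a $B$-module and a $B$-comodule. For a $B$-comodule $(V,\Delta_V)$ put $V^G=\{v\in V:\Delta_V(v)=v\otimes 1\}$; in particular $A^G=\{a\in A:\Delta(a)=a\otimes 1\}$ is a $k$-subalgebra of $A$. Let $\mathfrak g_-$ be the $k$-vector space of odd left-invariant $k$-superderivations of $A$, that is of odd $k$-linear maps $D:A\to A$ with $D(ab)=D(a)b+(-1)^{|a|}aD(b)$ for homogeneous $a$ and all $b$, and $m^*\circ D=(\mathrm{id}\otimes^\varepsilon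 D)\circ m^*$, where $(\mathrm{id}\otimes^\varepsilon D)(a\otimes b)=(-1)^{|a|}a\otimes D(b)$. Then $\mathfrak g_-$ is finite dimensional; put $s=\dim_k\mathfrak g_-$. There exist odd elements $\theta_1,\dots,\theta_s\in A^G\cap A_-$ whose classes form a $k$-basis of $(J/J^2)^G$, and for every such choice $A^G$ is the superpolynomial (exterior) algebra over $k$ in the odd variables $\theta_i$: there is an isomorphism of $k$-algebras $\Lambda_k(k^s)\to A^G$ that sends the $i$-th standard basis vector to $\theta_i$. Moreover, for every $n\ge 0$ the $B$-module $J^n/J^{n+1}$ is free of finite rank $\binom{s}{n}$, and $\dim_k A^G=2^s$. -/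

import Mathlib

open scoped TensorProduct

namespace SuperHopf

set_option linter.unusedSectionVars false

section Basic

variable {k A : Type*} [Field k] [Ring A] [Algebra k A]
variable (𝒜 : ZMod 2 → Submodule k A)

/-- The part of parity `i` of the super vector space `A ⊗ A`, for `A = 𝒜 0 ⊕ 𝒜 1`. -/
def tensorPart (i : ZMod 2) : Submodule k (A ⊗[k] A) :=
  ⨆ p : ZMod 2, LinearMap.range (TensorProduct.map (𝒜 p).subtype (𝒜 (i - p)).subtype)

/-- A super-affine Hopf algebra over `k`: a finitely generated super-commutative `k`-algebra
`A = 𝒜 0 ⊕ 𝒜 1` with a coalgebra structure and an antipode such that the comultiplication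
(with values in the super tensor product `𝒜 ᵍ⊗[k] 𝒜`), the counit and the antipode are
morphisms of super algebras. -/
class IsSuperAffineHopfAlgebra [GradedAlgebra 𝒜] [Coalgebra k A] : Prop where
  finiteType : Algebra.FiniteType k A
  superComm : ∀ (i j : ZMod 2) (a b : A), a ∈ 𝒜 i → b ∈ 𝒜 j →
    a * b = ((-1 : ℤˣ) ^ (i * j)) • (b * a)
  comul_mem : ∀ (i : ZMod 2) (a : A), a ∈ 𝒜 i → Coalgebra.comul (R := k) a ∈ tensorPart 𝒜 i
  comul_one : GradedTensorProduct.of k 𝒜 𝒜 (Coalgebra.comul (R := k) (1 : A)) = 1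
  comul_mul : ∀ a b : A, GradedTensorProduct.of k 𝒜 𝒜 (Coalgebra.comul (R := k) (a * b)) =
    GradedTensorProduct.of k 𝒜 𝒜 (Coalgebra.comul (R := k) a) *
      GradedTensorProduct.of k 𝒜 𝒜 (Coalgebra.comul (R := k) b)
  counit_odd : ∀ a : A, a ∈ 𝒜 1 → Coalgebra.counit (R := k) a = 0
  counit_one : Coalgebra.counit (R := k) (1 : A) = 1
  counit_mul : ∀ a b : A, Coalgebra.counit (R := k) (a * b) =
    Coalgebra.counit (R := k) a * Coalgebra.counit (R := k) b
  exists_antipode : ∃ S : A →ₐ[k] A,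
    (∀ (i : ZMod 2) (a : A), a ∈ 𝒜 i → S a ∈ 𝒜 i) ∧
    LinearMap.mul' k A ∘ₗ TensorProduct.map S.toLinearMap LinearMap.id ∘ₗ Coalgebra.comul =
      Algebra.linearMap k A ∘ₗ Coalgebra.counit ∧
    LinearMap.mul' k A ∘ₗ TensorProduct.map LinearMap.id S.toLinearMap ∘ₗ Coalgebra.comul =
      Algebra.linearMap k A ∘ₗ Coalgebra.counit

/-- The super radical: the ideal generated by the odd part. -/
def superRadical : Ideal A := Ideal.span (𝒜 1 : Set A)

end Basic

noncomputable section

variable {k A : Type*} [Field k] [Ring A] [Algebra k A] [Coalgebra k A]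
variable (𝒜 : ZMod 2 → Submodule k A) [GradedAlgebra 𝒜]

/-- The parity automorphism `a ↦ (-1)^|a| a`. -/
def parity : Module.End k A := GradedAlgebra.proj 𝒜 0 - GradedAlgebra.proj 𝒜 1

/-- The part of parity `p` of the Lie superalgebra of `A`: the `k`-superderivations `D` of
parity `p` that are left-invariant, that is `comul ∘ D = (id ⊗ D) ∘ comul`, where by the sign
rule `(id ⊗ D) (a ⊗ b) = (-1)^(p|a|) a ⊗ D b`. -/
def lieAlg (p : ZMod 2) : Submodule k (Module.End k A) where
  carrier := {D | (∀ (i : ZMod 2) (a : A), a ∈ 𝒜 i → D a ∈ 𝒜 (i + p)) ∧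
    (∀ a b : A, D (a * b) = D a * b + (parity 𝒜 ^ p.val) a * D b) ∧
    Coalgebra.comul ∘ₗ D = TensorProduct.map (parity 𝒜 ^ p.val) D ∘ₗ Coalgebra.comul}
  add_mem' := by
    rintro D E ⟨h1, h2, h3⟩ ⟨g1, g2, g3⟩
    refine ⟨fun i a ha => (𝒜 (i + p)).add_mem (h1 i a ha) (g1 i a ha), fun a b => ?_, ?_⟩
    · simp only [LinearMap.add_apply, h2, g2, add_mul, mul_add]
      abel
    · rw [LinearMap.comp_add, h3, g3, TensorProduct.map_add_right, LinearMap.add_comp]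
  zero_mem' := by
    refine ⟨fun i a _ => (𝒜 (i + p)).zero_mem, fun a b => ?_, ?_⟩
    · simp
    · simp
  smul_mem' := by
    rintro c D ⟨h1, h2, h3⟩
    refine ⟨fun i a ha => (𝒜 (i + p)).smul_mem c (h1 i a ha), fun a b => ?_, ?_⟩
    · simp only [LinearMap.smul_apply, h2, smul_add, smul_mul_assoc, mul_smul_comm]
    · rw [LinearMap.comp_smul, h3, TensorProduct.map_smul_right, LinearMap.smul_comp]

variable [IsSuperAffineHopfAlgebra 𝒜]

theorem eq_zero_or_one : ∀ j : ZMod 2, j = 0 ∨ j = 1 := by decide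

theorem even_add_odd (a : A) : ∃ b ∈ 𝒜 0, ∃ c ∈ 𝒜 1, a = b + c := by
  classical
  refine ⟨_, (DirectSum.decompose 𝒜 a 0).2, _, (DirectSum.decompose 𝒜 a 1).2, ?_⟩
  conv_lhs => rw [← DirectSum.sum_support_decompose 𝒜 a]
  rw [Finset.sum_subset (Finset.subset_univ _) (fun i _ hi => by simpa using hi)]
  exact Fin.sum_univ_two _

theorem even_comm {a : A} (ha : a ∈ 𝒜 0) (b : A) : a * b = b * a := by
  obtain ⟨b0, h0, b1, h1, rfl⟩ := even_add_odd 𝒜 b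
  have e0 := IsSuperAffineHopfAlgebra.superComm 0 0 a b0 ha h0
  have e1 := IsSuperAffineHopfAlgebra.superComm 0 1 a b1 ha h1
  rw [zero_mul, uzpow_zero, one_smul] at e0 e1
  rw [mul_add, add_mul, e0, e1]

theorem odd_mem {a : A} (ha : a ∈ 𝒜 1) : a ∈ superRadical 𝒜 := Ideal.subset_span ha

instance : (superRadical 𝒜).IsTwoSided := by
  refine ⟨fun {a} b ha => ?_⟩
  induction ha using Submodule.span_induction with
  | mem x hx =>
    obtain ⟨b0, h0, b1, h1, rfl⟩ := even_add_odd 𝒜 b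
    rw [mul_add, ← even_comm 𝒜 h0]
    refine Ideal.add_mem _ (Ideal.mul_mem_left _ _ (odd_mem 𝒜 hx))
      (Ideal.mul_mem_left _ _ (odd_mem 𝒜 h1))
  | zero => simp
  | add x y _ _ hx hy => rw [add_mul]; exact Ideal.add_mem _ hx hy
  | smul c x _ hx => rw [smul_mul_assoc]; exact Submodule.smul_mem _ c hx

/-- The coordinate ring `B = A / J` of the group scheme `G`. -/
abbrev evenQuotient : Type _ := A ⧸ superRadical 𝒜

/-- The projection `π : A → B`. -/
abbrev proj : A →ₐ[k] evenQuotient 𝒜 := Ideal.Quotient.mkₐ k (superRadical 𝒜)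

/-- The comultiplication as a homomorphism into the super tensor product. -/
def comulHom : A →ₐ[k] 𝒜 ᵍ⊗[k] 𝒜 :=
  AlgHom.ofLinearMap ((GradedTensorProduct.of k 𝒜 𝒜).toLinearMap ∘ₗ Coalgebra.comul)
    IsSuperAffineHopfAlgebra.comul_one IsSuperAffineHopfAlgebra.comul_mul

/-- The map `id ⊗ π : A ⊗ A → A ⊗ B`; since `B` is even, the super tensor product of `A` and `B`
is the usual one. -/
def idTensorProj : 𝒜 ᵍ⊗[k] 𝒜 →ₐ[k] A ⊗[k] evenQuotient 𝒜 :=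
  GradedTensorProduct.lift 𝒜 𝒜 Algebra.TensorProduct.includeLeft
    (Algebra.TensorProduct.includeRight.comp (proj 𝒜)) (by
      intro i j a b
      rcases eq_zero_or_one j with rfl | rfl
      · rw [zero_mul, uzpow_zero, one_smul]
        simp
      · have hb : proj 𝒜 (b : A) = 0 := Ideal.Quotient.eq_zero_iff_mem.2 (odd_mem 𝒜 b.2)
        have h0 : (Algebra.TensorProduct.includeRight.comp (proj 𝒜) : A →ₐ[k] A ⊗[k] _)
            (b : A) = 0 := by
          rw [AlgHom.comp_apply, hb, map_zero]
        rw [h0, mul_zero, zero_mul, smul_zero])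

theorem idTensorProj_of (x : A ⊗[k] A) :
    idTensorProj 𝒜 (GradedTensorProduct.of k 𝒜 𝒜 x) =
      LinearMap.lTensor A (proj 𝒜).toLinearMap x := by
  induction x with
  | zero => simp
  | add x y hx hy => simp only [map_add, hx, hy]
  | tmul a b =>
    refine (GradedTensorProduct.lift_tmul _ _ _ _ _ a b).trans ?_
    simp

/-- The `B`-comodule structure `Δ = (id ⊗ π) ∘ comul` of `A`. -/
def coaction : A →ₐ[k] A ⊗[k] evenQuotient 𝒜 := (idTensorProj 𝒜).comp (comulHom 𝒜)

/-- `A^G`, the subalgebra of all `a` with `Δ a = a ⊗ 1`. -/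
def invariants : Subalgebra k A :=
  AlgHom.equalizer (coaction 𝒜) Algebra.TensorProduct.includeLeft

/-- `J^n ⊗ B → A ⊗ B`. -/
def powTensor (n : ℕ) :
    ↥(superRadical 𝒜 ^ n) ⊗[k] evenQuotient 𝒜 →ₗ[k] A ⊗[k] evenQuotient 𝒜 :=
  LinearMap.rTensor _ ((superRadical 𝒜 ^ n).subtype.restrictScalars k)

theorem powTensor_injective (n : ℕ) : Function.Injective (powTensor 𝒜 n) :=
  Module.Flat.rTensor_preserves_injective_linearMap _ Subtype.val_injective

theorem tmul_mem_range (I : Ideal A) {a : A} (ha : a ∈ I) (b : evenQuotient 𝒜) :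
    a ⊗ₜ[k] b ∈ LinearMap.range
      (LinearMap.rTensor (evenQuotient 𝒜) (I.subtype.restrictScalars k)) :=
  ⟨(⟨a, ha⟩ : I) ⊗ₜ[k] b, rfl⟩

theorem mul_mem_range (I I' I'' : Ideal A) (h : ∀ a ∈ I, ∀ b ∈ I', a * b ∈ I'')
    {x y : A ⊗[k] evenQuotient 𝒜}
    (hx : x ∈ LinearMap.range
      (LinearMap.rTensor (evenQuotient 𝒜) (I.subtype.restrictScalars k)))
    (hy : y ∈ LinearMap.range
      (LinearMap.rTensor (evenQuotient 𝒜) (I'.subtype.restrictScalars k))) :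
    x * y ∈ LinearMap.range
      (LinearMap.rTensor (evenQuotient 𝒜) (I''.subtype.restrictScalars k)) := by
  obtain ⟨x, rfl⟩ := hx
  obtain ⟨y, rfl⟩ := hy
  induction x with
  | zero => simp
  | add x x' hx hx' => rw [map_add, add_mul]; exact Submodule.add_mem _ hx hx'
  | tmul a b =>
    induction y with
    | zero => simp
    | add y y' hy hy' => rw [map_add, mul_add]; exact Submodule.add_mem _ hy hy'
    | tmul c d =>
      rw [LinearMap.rTensor_tmul, LinearMap.rTensor_tmul, Algebra.TensorProduct.tmul_mul_tmul]
      exact tmul_mem_range 𝒜 I'' (h _ a.2 _ c.2) _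

theorem mem_range_top (I : Ideal A) (hI : ∀ a, a ∈ I) (x : A ⊗[k] evenQuotient 𝒜) :
    x ∈ LinearMap.range
      (LinearMap.rTensor (evenQuotient 𝒜) (I.subtype.restrictScalars k)) := by
  induction x with
  | zero => simp
  | add x y hx hy => exact Submodule.add_mem _ hx hy
  | tmul a b => exact tmul_mem_range 𝒜 I (hI a) b

theorem coaction_odd_mem {x : A} (hx : x ∈ 𝒜 1) :
    coaction 𝒜 x ∈ LinearMap.range
      (LinearMap.rTensor (evenQuotient 𝒜) ((superRadical 𝒜).subtype.restrictScalars k)) := by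
  have h := IsSuperAffineHopfAlgebra.comul_mem (𝒜 := 𝒜) 1 x hx
  have e : coaction 𝒜 x = LinearMap.lTensor A (proj 𝒜).toLinearMap (Coalgebra.comul x) :=
    idTensorProj_of 𝒜 _
  rw [e]
  suffices H : tensorPart 𝒜 1 ≤ (LinearMap.range (LinearMap.rTensor (evenQuotient 𝒜)
      ((superRadical 𝒜).subtype.restrictScalars k))).comap
        (LinearMap.lTensor A (proj 𝒜).toLinearMap) from H h
  refine iSup_le fun p => ?_
  rintro _ ⟨t, rfl⟩
  induction t with
  | zero => simp
  | add t u ht hu => rw [map_add]; exact Submodule.add_mem _ ht hu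
  | tmul a b =>
    rw [TensorProduct.map_tmul, Submodule.mem_comap, LinearMap.lTensor_tmul]
    rcases eq_zero_or_one p with rfl | rfl
    · have hb : (proj 𝒜).toLinearMap ((𝒜 (1 - 0)).subtype b) = 0 :=
        Ideal.Quotient.eq_zero_iff_mem.2 (odd_mem 𝒜 (by simpa using b.2))
      rw [hb, TensorProduct.tmul_zero]
      exact Submodule.zero_mem _
    · exact tmul_mem_range 𝒜 _ (odd_mem 𝒜 a.2) _

theorem coaction_rad_mem {x : A} (hx : x ∈ superRadical 𝒜) :
    coaction 𝒜 x ∈ LinearMap.range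
      (LinearMap.rTensor (evenQuotient 𝒜) ((superRadical 𝒜).subtype.restrictScalars k)) := by
  induction hx using Submodule.span_induction with
  | mem x hx => exact coaction_odd_mem 𝒜 hx
  | zero => rw [map_zero]; exact Submodule.zero_mem _
  | add x y _ _ hx hy => rw [map_add]; exact Submodule.add_mem _ hx hy
  | smul c x _ hx =>
    rw [smul_eq_mul, map_mul]
    exact mul_mem_range 𝒜 ⊤ _ _ (fun a _ b hb => Ideal.mul_mem_left _ a hb)
      (mem_range_top 𝒜 ⊤ (fun _ => trivial) _) hx

theorem coaction_mem (n : ℕ) {x : A} (hx : x ∈ superRadical 𝒜 ^ n) :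
    coaction 𝒜 x ∈ LinearMap.range (powTensor 𝒜 n) := by
  induction n generalizing x with
  | zero =>
    refine mem_range_top 𝒜 _ (fun a => ?_) _
    rw [Submodule.pow_zero, Ideal.one_eq_top]
    trivial
  | succ n ih =>
    rw [Ideal.IsTwoSided.pow_succ] at hx
    induction hx using Submodule.smul_induction_on' with
    | smul r hr y hy =>
      rw [smul_eq_mul, map_mul]
      refine mul_mem_range 𝒜 _ _ _ (fun a ha b hb => ?_) (coaction_rad_mem 𝒜 hr) (ih hy)
      rw [Ideal.IsTwoSided.pow_succ]
      exact Ideal.mul_mem_mul ha hb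
    | add x _ y _ hx hy => rw [map_add]; exact Submodule.add_mem _ hx hy

/-- The `B`-comodule structure of `J^n`. -/
def powCoaction (n : ℕ) :
    ↥(superRadical 𝒜 ^ n) →ₗ[k] ↥(superRadical 𝒜 ^ n) ⊗[k] evenQuotient 𝒜 :=
  (LinearEquiv.ofInjective (powTensor 𝒜 n) (powTensor_injective 𝒜 n)).symm.toLinearMap ∘ₗ
    LinearMap.codRestrict (LinearMap.range (powTensor 𝒜 n))
      ((coaction 𝒜).toLinearMap ∘ₗ (superRadical 𝒜 ^ n).subtype.restrictScalars k)
      (fun x => coaction_mem 𝒜 n x.2)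

theorem powTensor_powCoaction (n : ℕ) (x : ↥(superRadical 𝒜 ^ n)) :
    powTensor 𝒜 n (powCoaction 𝒜 n x) = coaction 𝒜 (x : A) :=
  congrArg Subtype.val ((LinearEquiv.ofInjective (powTensor 𝒜 n)
    (powTensor_injective 𝒜 n)).apply_symm_apply _)

/-- The quotient `J^n / J^(n+1)`. -/
abbrev gr (n : ℕ) : Type _ :=
  ↥(superRadical 𝒜 ^ n) ⧸ (superRadical 𝒜 ^ (n + 1)).submoduleOf (superRadical 𝒜 ^ n)

/-- The projection `J^n → J^n / J^(n+1)`. -/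
abbrev grMk (n : ℕ) : ↥(superRadical 𝒜 ^ n) →ₗ[A] gr 𝒜 n := Submodule.mkQ _

theorem gr_torsion (n : ℕ) :
    Module.IsTorsionBySet A (gr 𝒜 n) (superRadical 𝒜 : Set A) := by
  intro x a
  induction x using Submodule.Quotient.induction_on with
  | _ x =>
  refine (Submodule.Quotient.mk_eq_zero _).2 ?_
  change (a : A) * (x : A) ∈ superRadical 𝒜 ^ (n + 1)
  rw [Ideal.IsTwoSided.pow_succ]
  exact Ideal.mul_mem_mul a.2 x.2

/-- The `B`-module structure of `J^n / J^(n+1)`, induced by multiplication in `A`. -/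
instance (n : ℕ) : Module (evenQuotient 𝒜) (gr 𝒜 n) := (gr_torsion 𝒜 n).module

theorem grCoaction_aux (n : ℕ) (x : ↥(superRadical 𝒜 ^ n))
    (hx : (x : A) ∈ superRadical 𝒜 ^ (n + 1)) :
    LinearMap.rTensor (evenQuotient 𝒜) ((grMk 𝒜 n).restrictScalars k) (powCoaction 𝒜 n x) = 0 := by
  have hle : superRadical 𝒜 ^ (n + 1) ≤ superRadical 𝒜 ^ n := Ideal.pow_le_pow_right n.le_succ
  let j : ↥(superRadical 𝒜 ^ (n + 1)) →ₗ[k] ↥(superRadical 𝒜 ^ n) :=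
    (Submodule.inclusion hle).restrictScalars k
  have e : powCoaction 𝒜 n x =
      LinearMap.rTensor (evenQuotient 𝒜) j (powCoaction 𝒜 (n + 1) ⟨x, hx⟩) := by
    apply powTensor_injective 𝒜 n
    rw [powTensor_powCoaction, powTensor, ← LinearMap.comp_apply, ← LinearMap.rTensor_comp]
    exact (powTensor_powCoaction 𝒜 (n + 1) ⟨x, hx⟩).symm
  have z : (grMk 𝒜 n).restrictScalars k ∘ₗ j = 0 := by
    ext y
    exact (Submodule.Quotient.mk_eq_zero _).2 y.2
  rw [e, ← LinearMap.comp_apply, ← LinearMap.rTensor_comp, z, LinearMap.rTensor_zero,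
    LinearMap.zero_apply]

/-- The `B`-comodule structure of `J^n / J^(n+1)` as a quotient of `J^n`. -/
def grCoaction (n : ℕ) : gr 𝒜 n →ₗ[k] gr 𝒜 n ⊗[k] evenQuotient 𝒜 :=
  (((superRadical 𝒜 ^ (n + 1)).submoduleOf (superRadical 𝒜 ^ n)).restrictScalars k).liftQ
    (LinearMap.rTensor _ ((grMk 𝒜 n).restrictScalars k) ∘ₗ powCoaction 𝒜 n) (fun x hx => grCoaction_aux 𝒜 n x hx) ∘ₗ
  (Submodule.Quotient.restrictScalarsEquiv k _).symm.toLinearMap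

/-- The invariants `(J^n / J^(n+1))^G`. -/
def grInvariants (n : ℕ) : Submodule k (gr 𝒜 n) :=
  LinearMap.eqLocus (grCoaction 𝒜 n)
    ((TensorProduct.mk k (gr 𝒜 n) (evenQuotient 𝒜)).flip 1)

theorem odd_mem_pow_one {a : A} (ha : a ∈ 𝒜 1) : a ∈ superRadical 𝒜 ^ 1 := by
  rw [Submodule.pow_one]
  exact odd_mem 𝒜 ha

/-- The family `θ` consists of odd `G`-invariant elements (of `J`) representing a `k`-basis of
`(J / J^2)^G`. -/
structure IsOddCoordinates {s : ℕ} (θ : Fin s → A) : Prop where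
  odd : ∀ i, θ i ∈ 𝒜 1
  invariant : ∀ i, θ i ∈ invariants 𝒜
  linearIndependent : LinearIndependent k fun i => grMk 𝒜 1 ⟨θ i, odd_mem_pow_one 𝒜 (odd i)⟩
  span_eq : Submodule.span k (Set.range fun i => grMk 𝒜 1 ⟨θ i, odd_mem_pow_one 𝒜 (odd i)⟩) =
    grInvariants 𝒜 1



end

end SuperHopf

open scoped TensorProduct

namespace SuperHopf

set_option linter.unusedSectionVars false

noncomputable section

section Comodule

open Coalgebra

variable {k B : Type*} [Field k] [CommRing B] [HopfAlgebra k B]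

section Cohomology

variable {L M N : Type*} [AddCommGroup L] [Module k L] [AddCommGroup M] [Module k M]
  [AddCommGroup N] [Module k N]

/-- A linear map `M → M ⊗ B` is coassociative. -/
def IsCoassoc (ρ : M →ₗ[k] M ⊗[k] B) : Prop :=
  ∀ m, LinearMap.rTensor B ρ (ρ m) =
    (TensorProduct.assoc k M B B).symm (LinearMap.lTensor M comul (ρ m))

/-- The differential `m ↦ ρ m - m ⊗ 1` of the cobar complex in degree zero. -/
def cobar (ρ : M →ₗ[k] M ⊗[k] B) : M →ₗ[k] M ⊗[k] B :=
  ρ - (TensorProduct.mk k M B).flip 1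

theorem cobar_apply (ρ : M →ₗ[k] M ⊗[k] B) (m : M) : cobar ρ m = ρ m - m ⊗ₜ[k] 1 := rfl

/-- The differential of the cobar complex in degree one. -/
def cobarOne (ρ : M →ₗ[k] M ⊗[k] B) : M ⊗[k] B →ₗ[k] (M ⊗[k] B) ⊗[k] B :=
  LinearMap.rTensor B ρ - (TensorProduct.assoc k M B B).symm.toLinearMap ∘ₗ
    LinearMap.lTensor M comul + (TensorProduct.mk k (M ⊗[k] B) B).flip 1

theorem cobarOne_apply (ρ : M →ₗ[k] M ⊗[k] B) (z : M ⊗[k] B) :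
    cobarOne ρ z = LinearMap.rTensor B ρ z -
      (TensorProduct.assoc k M B B).symm (LinearMap.lTensor M comul z) + z ⊗ₜ[k] 1 := rfl

theorem cobarOne_cobar {ρ : M →ₗ[k] M ⊗[k] B} (h : IsCoassoc ρ) (m : M) :
    cobarOne ρ (cobar ρ m) = 0 := by
  rw [cobarOne_apply, cobar_apply, map_sub, h, map_sub, map_sub, LinearMap.rTensor_tmul,
    LinearMap.lTensor_tmul, Bialgebra.comul_one, Algebra.TensorProduct.one_def,
    TensorProduct.assoc_symm_tmul, TensorProduct.sub_tmul]
  abel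

/-- The first cohomology of the comodule vanishes. -/
def IsAcyclic (ρ : M →ₗ[k] M ⊗[k] B) : Prop :=
  ∀ z, cobarOne ρ z = 0 → ∃ m, cobar ρ m = z

/-- `f` is a morphism of comodules. -/
def IsComoduleHom (ρ : M →ₗ[k] M ⊗[k] B) (ρ' : N →ₗ[k] N ⊗[k] B) (f : M →ₗ[k] N) : Prop :=
  ∀ m, LinearMap.rTensor B f (ρ m) = ρ' (f m)

variable {ρL : L →ₗ[k] L ⊗[k] B} {ρ : M →ₗ[k] M ⊗[k] B} {ρN : N →ₗ[k] N ⊗[k] B}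

theorem IsComoduleHom.cobar {f : M →ₗ[k] N} (hf : IsComoduleHom ρ ρN f) (m : M) :
    LinearMap.rTensor B f (cobar ρ m) = SuperHopf.cobar ρN (f m) := by
  rw [cobar_apply, cobar_apply, map_sub, hf, LinearMap.rTensor_tmul]

theorem IsComoduleHom.cobarOne {f : M →ₗ[k] N} (hf : IsComoduleHom ρ ρN f) (z : M ⊗[k] B) :
    LinearMap.rTensor B (LinearMap.rTensor B f) (cobarOne ρ z) =
      SuperHopf.cobarOne ρN (LinearMap.rTensor B f z) := by
  rw [cobarOne_apply, cobarOne_apply, map_add, map_sub, LinearMap.rTensor_tmul]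
  congr 2
  · induction z with
    | zero => simp
    | add x y hx hy => simp only [map_add, hx, hy]
    | tmul m b => simp only [LinearMap.rTensor_tmul, hf m]
  · induction z with
    | zero => simp
    | add x y hx hy => simp only [map_add, hx, hy]
    | tmul m b =>
      simp only [LinearMap.rTensor_tmul, LinearMap.lTensor_tmul]
      induction comul (R := k) b with
      | zero => simp
      | add x y hx hy => simp only [map_add, TensorProduct.tmul_add, hx, hy]
      | tmul b c => simp

section Exact

variable {j : L →ₗ[k] M} {q : M →ₗ[k] N} (hj : IsComoduleHom ρL ρ j) (hq : IsComoduleHom ρ ρN q)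
  (hji : Function.Injective j) (hex : Function.Exact j q) (hqs : Function.Surjective q)

include hj hji hex hqs in
theorem exists_cobar_add {w : M ⊗[k] B} (hL : IsAcyclic ρL) (hw : cobarOne ρ w = 0)
    (h0 : LinearMap.rTensor B q w = 0) : ∃ l, cobar ρ (j l) = w := by
  obtain ⟨u, rfl⟩ := (rTensor_exact B hex hqs w).1 h0
  have hu : cobarOne ρL u = 0 := by
    apply Module.Flat.rTensor_preserves_injective_linearMap (M := B) _
      (Module.Flat.rTensor_preserves_injective_linearMap (M := B) j hji)
    rw [hj.cobarOne, hw, map_zero]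
  obtain ⟨l, rfl⟩ := hL u hu
  exact ⟨l, (hj.cobar l).symm⟩

include hj hq hji hex hqs in
theorem IsAcyclic.extension (h : IsCoassoc ρ) (hL : IsAcyclic ρL) (hN : IsAcyclic ρN) :
    IsAcyclic ρ := by
  intro z hz
  obtain ⟨n, hn⟩ := hN (LinearMap.rTensor B q z) (by rw [← hq.cobarOne, hz, map_zero])
  obtain ⟨m, rfl⟩ := hqs n
  obtain ⟨l, hl⟩ := exists_cobar_add (w := z - cobar ρ m) hj hji hex hqs hL
    (by rw [map_sub, hz, cobarOne_cobar h, sub_zero])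
    (by rw [map_sub, hq.cobar, hn, sub_self])
  exact ⟨j l + m, by rw [map_add, hl, sub_add_cancel]⟩

include hj hq hji hex hqs in
theorem exists_invariant_lift (h : IsCoassoc ρ) (hL : IsAcyclic ρL) {n : N}
    (hn : ρN n = n ⊗ₜ[k] 1) : ∃ m, ρ m = m ⊗ₜ[k] 1 ∧ q m = n := by
  obtain ⟨m, rfl⟩ := hqs n
  obtain ⟨l, hl⟩ := exists_cobar_add (w := cobar ρ m) hj hji hex hqs hL
    (cobarOne_cobar h m) (by rw [hq.cobar, cobar_apply, hn, sub_self])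
  refine ⟨m - j l, ?_, ?_⟩
  · rw [← sub_eq_zero, ← cobar_apply, map_sub, hl, sub_self]
  · rw [map_sub, hex.apply_apply_eq_zero, sub_zero]

end Exact

end Cohomology

section HopfModule

variable {M : Type*} [AddCommGroup M] [Module k M] [Module B M] [IsScalarTower k B M]

/-- The action of `B ⊗ B` on `M ⊗ B`. -/
def tensorAct : B ⊗[k] B →ₗ[k] M ⊗[k] B →ₗ[k] M ⊗[k] B :=
  TensorProduct.map₂ (Algebra.lsmul k k M).toLinearMap (LinearMap.mul k B)

@[simp]
theorem tensorAct_tmul (b c d : B) (m : M) :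
    tensorAct (b ⊗ₜ[k] c) (m ⊗ₜ[k] d) = (b • m) ⊗ₜ[k] (c * d) := rfl

/-- `ρ` makes the `B`-module `M` into a (right) Hopf module. -/
structure IsHopfModule (ρ : M →ₗ[k] M ⊗[k] B) : Prop where
  coassoc : IsCoassoc ρ
  counit : ∀ m, LinearMap.lTensor M (counit (R := k)) (ρ m) = m ⊗ₜ[k] (1 : k)
  smul : ∀ (b : B) (m : M), ρ (b • m) = tensorAct (comul b) (ρ m)

/-- The map `m ⊗ b ↦ S b • m`. -/
def antipodeAct : M ⊗[k] B →ₗ[k] M :=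
  TensorProduct.lift ((Algebra.lsmul k k M).toLinearMap ∘ₗ HopfAlgebra.antipode k (A := B)).flip

@[simp]
theorem antipodeAct_tmul (m : M) (b : B) :
    antipodeAct (m ⊗ₜ[k] b) = HopfAlgebra.antipode k b • m := rfl

/-- The map `(m ⊗ c) ⊗ b ↦ Δ(S b) (m ⊗ c)`. -/
def comulAntipodeAct : (M ⊗[k] B) ⊗[k] B →ₗ[k] M ⊗[k] B :=
  TensorProduct.lift (tensorAct ∘ₗ comul ∘ₗ HopfAlgebra.antipode k (A := B)).flip

@[simp]
theorem comulAntipodeAct_tmul (x : M ⊗[k] B) (b : B) :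
    comulAntipodeAct (x ⊗ₜ[k] b) = tensorAct (comul (HopfAlgebra.antipode k b)) x := rfl

theorem tensorAct_eq_mul (x : B ⊗[k] B) (m : M) (b : B) :
    tensorAct x (m ⊗ₜ[k] b) = tensorAct (x * 1 ⊗ₜ b) (m ⊗ₜ[k] 1) := by
  induction x with
  | zero => simp
  | add x y hx hy => simp only [map_add, add_mul, LinearMap.add_apply, hx, hy]
  | tmul c d => simp

open WithConv Algebra.TensorProduct in
theorem includeRight_mul_comul_antipode (b : B) :
    LinearMap.mul' k (B ⊗[k] B) (TensorProduct.map
      (includeRight : B →ₐ[k] B ⊗[k] B).toLinearMap (comul ∘ₗ HopfAlgebra.antipode k) (comul b)) =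
      HopfAlgebra.antipode k b ⊗ₜ[k] 1 := by
  let l : WithConv (B →ₐ[k] B ⊗[k] B) := toConv includeLeft
  let r : WithConv (B →ₐ[k] B ⊗[k] B) := toConv includeRight
  have h : l * r = toConv (Bialgebra.comulAlgHom k B) := by
    apply WithConv.ext
    apply AlgHom.toLinearMap_injective
    have e : (lmul' k).comp (Algebra.TensorProduct.map (includeLeft (S := k))
        (includeRight : B →ₐ[k] B ⊗[k] B)) = AlgHom.id k (B ⊗[k] B) := by
      ext <;> simp
    ext x
    exact congr($e (comul x))
  have h' : r * (toConv (Bialgebra.comulAlgHom k B))⁻¹ = l⁻¹ := by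
    have gen : ∀ {G : Type _} [Group G] (x y : G), y * (x * y)⁻¹ = x⁻¹ := by
      intro G _ x y
      rw [mul_inv_rev, mul_inv_cancel_left]
    rw [← h]
    exact gen l r
  exact congr(($h').ofConv b)

theorem comulAntipodeAct_comul (u : M ⊗[k] B) :
    comulAntipodeAct ((TensorProduct.assoc k M B B).symm (LinearMap.lTensor M comul u)) =
      antipodeAct u ⊗ₜ[k] 1 := by
  induction u with
  | zero => simp
  | add x y hx hy => simp only [map_add, TensorProduct.add_tmul, hx, hy]
  | tmul m b =>
    have e : ∀ x : B ⊗[k] B, comulAntipodeAct ((TensorProduct.assoc k M B B).symm (m ⊗ₜ[k] x)) =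
        tensorAct (LinearMap.mul' k (B ⊗[k] B) (TensorProduct.map
          (Algebra.TensorProduct.includeRight : B →ₐ[k] B ⊗[k] B).toLinearMap
          (comul ∘ₗ HopfAlgebra.antipode k) x)) (m ⊗ₜ[k] 1) := by
      intro x
      induction x with
      | zero => simp
      | add x y hx hy => simp only [TensorProduct.tmul_add, map_add, LinearMap.add_apply, hx, hy]
      | tmul c d =>
        rw [TensorProduct.assoc_symm_tmul, comulAntipodeAct_tmul, tensorAct_eq_mul]
        simp [mul_comm]
    rw [LinearMap.lTensor_tmul, e, includeRight_mul_comul_antipode]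
    simp

theorem antipodeAct_tensorAct (x : B ⊗[k] B) (u : M ⊗[k] B) :
    antipodeAct (tensorAct x u) =
      LinearMap.mul' k B (LinearMap.lTensor B (HopfAlgebra.antipode k) x) • antipodeAct u := by
  induction x with
  | zero => simp
  | add x y hx hy => simp only [map_add, LinearMap.add_apply, add_smul, hx, hy]
  | tmul c d =>
    induction u with
    | zero => simp
    | add x y hx hy => simp only [map_add, smul_add, hx, hy]
    | tmul m b =>
      simp [HopfAlgebra.antipode_mul_distrib, smul_smul]
      congr 1
      ring

/-- The map `m ⊗ b ↦ b • m`. -/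
def act : M ⊗[k] B →ₗ[k] M := TensorProduct.lift (Algebra.lsmul k k M).toLinearMap.flip

@[simp]
theorem act_tmul (m : M) (b : B) : act (m ⊗ₜ[k] b) = b • m := rfl

theorem act_antipodeAct (u : M ⊗[k] B) :
    act (LinearMap.rTensor B antipodeAct
      ((TensorProduct.assoc k M B B).symm (LinearMap.lTensor M comul u))) =
      TensorProduct.rid k M (LinearMap.lTensor M counit u) := by
  induction u with
  | zero => simp
  | add x y hx hy => simp only [map_add, hx, hy]
  | tmul m b =>
    have e : ∀ x : B ⊗[k] B, act (LinearMap.rTensor B antipodeAct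
        ((TensorProduct.assoc k M B B).symm (m ⊗ₜ[k] x))) =
          LinearMap.mul' k B (LinearMap.rTensor B (HopfAlgebra.antipode k) x) • m := by
      intro x
      induction x with
      | zero => simp
      | add x y hx hy => simp only [TensorProduct.tmul_add, map_add, add_smul, hx, hy]
      | tmul c d => simp [smul_smul, mul_comm]
    rw [LinearMap.lTensor_tmul, e, HopfAlgebra.mul_antipode_rTensor_comul_apply]
    simp

namespace IsHopfModule

variable {ρ : M →ₗ[k] M ⊗[k] B} (h : IsHopfModule ρ)

include h

theorem coaction_antipodeAct (u : M ⊗[k] B) :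
    ρ (antipodeAct u) = comulAntipodeAct (LinearMap.rTensor B ρ u) := by
  induction u with
  | zero => simp
  | add x y hx hy => simp only [map_add, hx, hy]
  | tmul m b => simp [h.smul]

theorem isAcyclic : IsAcyclic ρ := by
  intro z hz
  have e := h.coaction_antipodeAct z
  rw [cobarOne_apply, sub_add_eq_add_sub, sub_eq_zero] at hz
  have e' := congr(comulAntipodeAct $hz)
  rw [map_add, ← e, comulAntipodeAct_comul, comulAntipodeAct_tmul, HopfAlgebra.antipode_one,
    Bialgebra.comul_one] at e'
  have e1 : tensorAct (1 : B ⊗[k] B) z = z := by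
    clear hz e e'
    induction z with
    | zero => simp
    | add x y hx hy => simp only [map_add, hx, hy]
    | tmul m b => simp [Algebra.TensorProduct.one_def]
  rw [e1] at e'
  refine ⟨-antipodeAct z, ?_⟩
  rw [cobar_apply, map_neg, TensorProduct.neg_tmul, ← e']
  abel

omit h in
variable (ρ) in
/-- The projection `m ↦ ∑ S m₁ • m₀` of a Hopf module onto its invariants. -/
def average : M →ₗ[k] M := antipodeAct ∘ₗ ρ

theorem coaction_average (m : M) : ρ (average ρ m) = average ρ m ⊗ₜ[k] 1 := by
  rw [average, LinearMap.comp_apply, h.coaction_antipodeAct, h.coassoc, comulAntipodeAct_comul]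

omit h in
theorem average_of_invariant {v : M} (hv : ρ v = v ⊗ₜ[k] 1) : average ρ v = v := by
  rw [average, LinearMap.comp_apply, hv, antipodeAct_tmul, HopfAlgebra.antipode_one, one_smul]

theorem average_smul (b : B) (m : M) : average ρ (b • m) = Coalgebra.counit (R := k) b • average ρ m := by
  rw [average, LinearMap.comp_apply, h.smul, antipodeAct_tensorAct,
    HopfAlgebra.mul_antipode_lTensor_comul_apply, algebraMap_smul, LinearMap.comp_apply]

theorem act_average (m : M) : act (LinearMap.rTensor B (average ρ) (ρ m)) = m := by
  rw [average, LinearMap.rTensor_comp, LinearMap.comp_apply, h.coassoc, act_antipodeAct, h.counit]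
  simp

theorem mem_span_invariants (m : M) : m ∈ Submodule.span B {v : M | ρ v = v ⊗ₜ[k] 1} := by
  rw [← h.act_average m]
  induction ρ m with
  | zero => simp
  | add x y hx hy => simp only [map_add]; exact Submodule.add_mem _ hx hy
  | tmul m b =>
    exact Submodule.smul_mem _ _ (Submodule.subset_span (h.coaction_average m))

theorem average_coaction_smul {v : M} (hv : ρ v = v ⊗ₜ[k] 1) (b : B) :
    LinearMap.rTensor B (average ρ) (ρ (b • v)) = v ⊗ₜ[k] b := by
  rw [h.smul, hv]
  have e : ∀ x : B ⊗[k] B, LinearMap.rTensor B (average ρ) (tensorAct x (v ⊗ₜ[k] 1)) =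
      v ⊗ₜ[k] TensorProduct.lid k B (LinearMap.rTensor B Coalgebra.counit x) := by
    intro x
    induction x with
    | zero => simp
    | add x y hx hy => simp only [map_add, LinearMap.add_apply, TensorProduct.tmul_add, hx, hy]
    | tmul c d =>
      simp [h.average_smul, average_of_invariant hv, TensorProduct.smul_tmul]
  rw [e, Coalgebra.rTensor_counit_comul]
  simp

theorem linearIndependent {ι : Type*} {v : ι → M} (hv : ∀ i, ρ (v i) = v i ⊗ₜ[k] 1)
    (hli : LinearIndependent k v) : LinearIndependent B v := by
  rw [linearIndependent_iff']
  intro s g hg i hi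
  have e := congr(LinearMap.rTensor B (average ρ) (ρ $hg))
  rw [map_sum, map_sum, map_zero, map_zero] at e
  simp only [h.average_coaction_smul (hv _)] at e
  obtain ⟨f, hf⟩ := LinearMap.exists_leftInverse_of_injective (Finsupp.linearCombination k v)
    (LinearMap.ker_eq_bot.2 hli)
  have hf' : ∀ j, f (v j) = Finsupp.single j 1 := fun j => by
    simpa using LinearMap.congr_fun hf (Finsupp.single j 1)
  have e' := congr(TensorProduct.lid k B (LinearMap.rTensor B (Finsupp.lapply i ∘ₗ f) $e))
  classical
  simpa [hf', Finsupp.single_apply, hi] using e'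

end IsHopfModule

end HopfModule

end Comodule

section Anticommuting

variable {k R : Type*} [Field k] [Ring R] [Algebra k R] {s : ℕ}

/-- The members of the family anticommute and have square zero. -/
structure IsAnticommuting (y : Fin s → R) : Prop where
  sq : ∀ i, y i * y i = 0
  anti : ∀ i j, y i * y j = -(y j * y i)

/-- The monomial `∏ i ∈ I, y i`, the factors being taken in increasing order. -/
def monomial (y : Fin s → R) (I : Finset (Fin s)) : R := (I.sort.map y).prod

variable {y : Fin s → R}

theorem map_monomial {R' F : Type*} [Ring R'] [FunLike F R R'] [MonoidHomClass F R R'] (f : F)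
    (I : Finset (Fin s)) : f (monomial y I) = monomial (fun i => f (y i)) I := by
  rw [monomial, map_list_prod, List.map_map]
  rfl

namespace IsAnticommuting

variable (hy : IsAnticommuting y)

include hy

theorem mul_prod_of_mem {i : Fin s} {l : List (Fin s)} (hi : i ∈ l) :
    y i * (l.map y).prod = 0 := by
  induction l with
  | nil => simp at hi
  | cons j l ih =>
    rw [List.map_cons, List.prod_cons, ← mul_assoc]
    rcases List.mem_cons.1 hi with rfl | h
    · rw [hy.sq, zero_mul]
    · rw [hy.anti, neg_mul, mul_assoc, ih h, mul_zero, neg_zero]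

theorem prod_eq_zero {l : List (Fin s)} (hl : ¬ l.Nodup) : (l.map y).prod = 0 := by
  induction l with
  | nil => simp at hl
  | cons j l ih =>
    rw [List.map_cons, List.prod_cons]
    by_cases h : j ∈ l
    · exact hy.mul_prod_of_mem h
    · rw [ih (fun hn => hl (List.nodup_cons.2 ⟨h, hn⟩)), mul_zero]

theorem prod_perm {l l' : List (Fin s)} (h : l.Perm l') :
    (l.map y).prod = (l'.map y).prod ∨ (l.map y).prod = -(l'.map y).prod := by
  induction h with
  | nil => simp
  | cons x _ ih =>
    simp only [List.map_cons, List.prod_cons]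
    rcases ih with e | e
    · exact Or.inl (by rw [e])
    · exact Or.inr (by rw [e, mul_neg])
  | swap i j l =>
    refine Or.inr ?_
    simp only [List.map_cons, List.prod_cons]
    rw [← mul_assoc, hy.anti, neg_mul, mul_assoc]
  | trans _ _ ih ih' =>
    rcases ih with e | e <;> rcases ih' with e' | e' <;> rw [e, e'] <;> simp

theorem prod_eq_zero_or (l : List (Fin s)) : (l.map y).prod = 0 ∨ ∃ I : Finset (Fin s),
    I.card = l.length ∧ ((l.map y).prod = monomial y I ∨ (l.map y).prod = -monomial y I) := by
  by_cases hl : l.Nodup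
  · refine Or.inr ⟨l.toFinset, List.toFinset_card_of_nodup hl, hy.prod_perm ?_⟩
    rw [List.perm_ext_iff_of_nodup hl (Finset.sort_nodup ..)]
    simp
  · exact Or.inl (hy.prod_eq_zero hl)

theorem prod_mem_span (l : List (Fin s)) :
    (l.map y).prod ∈ Submodule.span k (Set.range (monomial y)) := by
  rcases hy.prod_eq_zero_or l with e | ⟨I, -, e | e⟩ <;> rw [e]
  · exact Submodule.zero_mem _
  · exact Submodule.subset_span ⟨I, rfl⟩
  · exact Submodule.neg_mem _ (Submodule.subset_span ⟨I, rfl⟩)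

theorem prod_mem_ideal (l : List (Fin s)) :
    (l.map y).prod ∈ Ideal.span (monomial y '' {I | I.card = l.length}) := by
  rcases hy.prod_eq_zero_or l with e | ⟨I, hI, e | e⟩ <;> rw [e]
  · exact Submodule.zero_mem _
  · exact Ideal.subset_span ⟨I, hI, rfl⟩
  · exact Submodule.neg_mem _ (Ideal.subset_span ⟨I, hI, rfl⟩)

theorem span_monomial_of_adjoin (h : Algebra.adjoin k (Set.range y) = ⊤) :
    Submodule.span k (Set.range (monomial y)) = ⊤ := by
  rw [eq_top_iff, ← Algebra.top_toSubmodule, ← h, Algebra.adjoin_eq_span, Submodule.span_le]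
  intro x hx
  obtain ⟨l, hl, rfl⟩ := Submonoid.exists_list_of_mem_closure hx
  obtain ⟨l, rfl⟩ : ∃ l' : List (Fin s), l'.map y = l := by
    rw [← Set.mem_range, Set.range_list_map]
    exact hl
  exact hy.prod_mem_span l

theorem pow_le_span (hc : ∀ i c, ∃ c', y i * c = c' * y i) {K : Ideal R} [K.IsTwoSided]
    (hK : K ≤ Ideal.span (Set.range y)) (n : ℕ) :
    K ^ n ≤ Ideal.span (monomial y '' {I | I.card = n}) := by
  induction n with
  | zero =>
    have h1 : (1 : R) ∈ Ideal.span (monomial y '' {I | I.card = 0}) := hy.prod_mem_ideal []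
    exact fun x _ => by simpa using Ideal.mul_mem_left _ x h1
  | succ n ih =>
    rw [Ideal.IsTwoSided.pow_succ, Ideal.mul_le]
    intro x hx z hz
    replace hx := hK hx
    replace hz := ih hz
    induction hx using Submodule.span_induction with
    | zero => simp
    | add x x' _ _ h h' => rw [add_mul]; exact Ideal.add_mem _ h h'
    | smul a x _ h => rw [smul_eq_mul, mul_assoc]; exact Ideal.mul_mem_left _ a h
    | mem x hx =>
      obtain ⟨i, rfl⟩ := hx
      induction hz using Submodule.span_induction with
      | zero => simp
      | add x x' _ _ h h' => rw [mul_add]; exact Ideal.add_mem _ h h'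
      | smul a x _ h =>
        obtain ⟨c, hc⟩ := hc i a
        rw [smul_eq_mul, ← mul_assoc, hc, mul_assoc]
        exact Ideal.mul_mem_left _ c h
      | mem x hx =>
        obtain ⟨I, hI, rfl⟩ := hx
        have := hy.prod_mem_ideal (i :: I.sort)
        rwa [List.length_cons, Finset.length_sort, hI] at this

theorem pow_eq_bot (hc : ∀ i c, ∃ c', y i * c = c' * y i) {K : Ideal R} [K.IsTwoSided]
    (hK : K ≤ Ideal.span (Set.range y)) {n : ℕ} (hn : s < n) : K ^ n = ⊥ := by
  rw [eq_bot_iff]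
  refine (hy.pow_le_span hc hK n).trans ?_
  rw [Ideal.span_le]
  rintro _ ⟨I, hI, rfl⟩
  have h := Finset.card_le_univ I
  rw [hI, Fintype.card_fin] at h
  omega

end IsAnticommuting

theorem prod_mem_pow {K : Ideal R} [K.IsTwoSided] (hy : ∀ i, y i ∈ K) (l : List (Fin s)) :
    (l.map y).prod ∈ K ^ l.length := by
  induction l with
  | nil => rw [List.length_nil, Submodule.pow_zero, Ideal.one_eq_top]; trivial
  | cons i l ih =>
    rw [List.map_cons, List.prod_cons, List.length_cons, Ideal.IsTwoSided.pow_succ]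
    exact Ideal.mul_mem_mul (hy i) ih

theorem monomial_mem_pow {K : Ideal R} [K.IsTwoSided] (hy : ∀ i, y i ∈ K) (I : Finset (Fin s)) :
    monomial y I ∈ K ^ I.card := by
  have := prod_mem_pow hy I.sort
  rwa [Finset.length_sort] at this

end Anticommuting

section Transfer

open Coalgebra

variable {k B M N : Type*} [Field k] [CommRing B] [HopfAlgebra k B] [AddCommGroup M] [Module k M]
  [AddCommGroup N] [Module k N] {ρ : M →ₗ[k] M ⊗[k] B} {ρN : N →ₗ[k] N ⊗[k] B} {f : M →ₗ[k] N}

theorem isCoassoc_iff : IsCoassoc ρ ↔ ∀ m, cobarOne ρ (cobar ρ m) = 0 := by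
  refine ⟨fun h m => cobarOne_cobar h m, fun h m => ?_⟩
  have e := h m
  rw [cobarOne_apply, cobar_apply, map_sub, map_sub, map_sub, LinearMap.rTensor_tmul,
    LinearMap.lTensor_tmul, Bialgebra.comul_one, Algebra.TensorProduct.one_def,
    TensorProduct.assoc_symm_tmul, TensorProduct.sub_tmul] at e
  rw [← sub_eq_zero, ← e]
  abel

theorem IsComoduleHom.isCoassoc_of_injective (hf : IsComoduleHom ρ ρN f)
    (hi : Function.Injective f) (h : IsCoassoc ρN) : IsCoassoc ρ := by
  rw [isCoassoc_iff]
  intro m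
  apply Module.Flat.rTensor_preserves_injective_linearMap (M := B) _
    (Module.Flat.rTensor_preserves_injective_linearMap (M := B) f hi)
  rw [hf.cobarOne, hf.cobar, cobarOne_cobar h, map_zero]

theorem IsComoduleHom.isCoassoc_of_surjective (hf : IsComoduleHom ρ ρN f)
    (hs : Function.Surjective f) (h : IsCoassoc ρ) : IsCoassoc ρN := by
  rw [isCoassoc_iff]
  intro m
  obtain ⟨m, rfl⟩ := hs m
  rw [← hf.cobar, ← hf.cobarOne, cobarOne_cobar h, map_zero]

theorem IsComoduleHom.counit (hf : IsComoduleHom ρ ρN f) (m : M) :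
    LinearMap.lTensor N (counit (R := k)) (ρN (f m)) =
      LinearMap.rTensor k f (LinearMap.lTensor M (Coalgebra.counit (R := k)) (ρ m)) := by
  rw [← hf, ← LinearMap.comp_apply, LinearMap.lTensor_comp_rTensor,
    ← LinearMap.rTensor_comp_lTensor, LinearMap.comp_apply]

theorem isAcyclic_of_subsingleton [Subsingleton M] (ρ : M →ₗ[k] M ⊗[k] B) : IsAcyclic ρ := by
  intro z _
  have hz : ∀ z : M ⊗[k] B, z = 0 := by
    intro z
    induction z with
    | zero => rfl
    | add x y hx hy => rw [hx, hy, add_zero]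
    | tmul a b => rw [Subsingleton.elim a 0, TensorProduct.zero_tmul]
  exact ⟨0, by rw [hz z, map_zero]⟩

end Transfer

section

variable {k A : Type*} [Field k] [Ring A] [Algebra k A] [Coalgebra k A]
variable (𝒜 : ZMod 2 → Submodule k A) [GradedAlgebra 𝒜] [IsSuperAffineHopfAlgebra 𝒜]

theorem proj_odd {a : A} (ha : a ∈ 𝒜 1) : proj 𝒜 a = 0 :=
  Ideal.Quotient.eq_zero_iff_mem.2 (odd_mem 𝒜 ha)

theorem proj_surjective : Function.Surjective (proj 𝒜) := Ideal.Quotient.mk_surjective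

/-- The ring `B` is commutative. -/
abbrev evenQuotientCommRing : CommRing (evenQuotient 𝒜) where
  mul_comm := by
    intro x y
    obtain ⟨a, rfl⟩ := proj_surjective 𝒜 x
    obtain ⟨b, rfl⟩ := proj_surjective 𝒜 y
    obtain ⟨a0, h0, a1, h1, rfl⟩ := even_add_odd 𝒜 a
    rw [map_add, proj_odd 𝒜 h1, add_zero, ← map_mul, ← map_mul, even_comm 𝒜 h0]

end

attribute [local instance] evenQuotientCommRing

section

variable {k A : Type*} [Field k] [Ring A] [Algebra k A] [Coalgebra k A]
variable (𝒜 : ZMod 2 → Submodule k A) [GradedAlgebra 𝒜] [IsSuperAffineHopfAlgebra 𝒜]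

theorem coaction_apply (a : A) :
    coaction 𝒜 a = LinearMap.lTensor A (proj 𝒜).toLinearMap (Coalgebra.comul a) :=
  idTensorProj_of 𝒜 _

/-- The counit of `A` as a homomorphism of algebras. -/
def counitHom : A →ₐ[k] k :=
  AlgHom.ofLinearMap Coalgebra.counit (IsSuperAffineHopfAlgebra.counit_one 𝒜)
    (IsSuperAffineHopfAlgebra.counit_mul 𝒜)

theorem counitHom_odd {a : A} (ha : a ∈ 𝒜 1) : counitHom 𝒜 a = 0 :=
  IsSuperAffineHopfAlgebra.counit_odd a ha

theorem counitHom_rad {a : A} (ha : a ∈ superRadical 𝒜) : counitHom 𝒜 a = 0 := by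
  suffices h : superRadical 𝒜 ≤ RingHom.ker (counitHom 𝒜) from h ha
  exact Ideal.span_le.2 fun x hx => counitHom_odd 𝒜 hx

/-- The comultiplication of `B`. -/
def quotComul : evenQuotient 𝒜 →ₐ[k] evenQuotient 𝒜 ⊗[k] evenQuotient 𝒜 :=
  Ideal.Quotient.liftₐ (superRadical 𝒜)
    ((Algebra.TensorProduct.map (proj 𝒜) (AlgHom.id k (evenQuotient 𝒜))).comp (coaction 𝒜)) (by
      intro a ha
      obtain ⟨t, ht⟩ := coaction_rad_mem 𝒜 ha
      rw [AlgHom.comp_apply, ← ht]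
      clear ht
      induction t with
      | zero => simp
      | add x y hx hy => simp only [map_add, hx, hy, add_zero]
      | tmul a b =>
        have h0 : proj 𝒜 (a : A) = 0 := Ideal.Quotient.eq_zero_iff_mem.2 a.2
        rw [LinearMap.rTensor_tmul, Algebra.TensorProduct.map_tmul, LinearMap.restrictScalars_apply,
          Submodule.subtype_apply, h0, TensorProduct.zero_tmul])

theorem quotComul_coaction (a : A) : quotComul 𝒜 (proj 𝒜 a) =
    LinearMap.rTensor (evenQuotient 𝒜) (proj 𝒜).toLinearMap (coaction 𝒜 a) := rfl

theorem quotComul_proj (a : A) : quotComul 𝒜 (proj 𝒜 a) =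
    TensorProduct.map (proj 𝒜).toLinearMap (proj 𝒜).toLinearMap (Coalgebra.comul a) := by
  rw [quotComul_coaction, coaction_apply, ← LinearMap.comp_apply, LinearMap.rTensor_comp_lTensor]

/-- The counit of `B`. -/
def quotCounit : evenQuotient 𝒜 →ₐ[k] k :=
  Ideal.Quotient.liftₐ (superRadical 𝒜) (counitHom 𝒜) (fun _ ha => counitHom_rad 𝒜 ha)

theorem coassoc_of_proj (a : A) :
    TensorProduct.assoc k A (evenQuotient 𝒜) (evenQuotient 𝒜)
      (LinearMap.rTensor _ (coaction 𝒜).toLinearMap (coaction 𝒜 a)) =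
      LinearMap.lTensor A (quotComul 𝒜).toLinearMap (coaction 𝒜 a) := by
  let p := (proj 𝒜).toLinearMap
  have e1 : ∀ x : A ⊗[k] A, TensorProduct.assoc k A (evenQuotient 𝒜) (evenQuotient 𝒜)
      (LinearMap.rTensor _ (coaction 𝒜).toLinearMap (LinearMap.lTensor A p x)) =
      LinearMap.lTensor A (TensorProduct.map p p) (TensorProduct.assoc k A A A
        (LinearMap.rTensor A Coalgebra.comul x)) := by
    intro x
    induction x with
    | zero => simp
    | add x y hx hy => simp only [map_add, hx, hy]
    | tmul a b =>
      rw [LinearMap.lTensor_tmul, LinearMap.rTensor_tmul, LinearMap.rTensor_tmul,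
        AlgHom.toLinearMap_apply, coaction_apply]
      induction (Coalgebra.comul a : A ⊗[k] A) with
      | zero => simp
      | add x y hx hy => simp only [map_add, TensorProduct.add_tmul, hx, hy]
      | tmul c d => rfl
  have e2 : ∀ x : A ⊗[k] A, LinearMap.lTensor A (quotComul 𝒜).toLinearMap
      (LinearMap.lTensor A p x) = LinearMap.lTensor A (TensorProduct.map p p)
        (LinearMap.lTensor A Coalgebra.comul x) := by
    intro x
    induction x with
    | zero => simp
    | add x y hx hy => simp only [map_add, hx, hy]
    | tmul a b =>
      rw [LinearMap.lTensor_tmul, LinearMap.lTensor_tmul, LinearMap.lTensor_tmul,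
        LinearMap.lTensor_tmul, ← quotComul_proj]
      rfl
  rw [coaction_apply, e1, e2, Coalgebra.coassoc_apply]

theorem coaction_counit (a : A) :
    LinearMap.lTensor A (quotCounit 𝒜).toLinearMap (coaction 𝒜 a) = a ⊗ₜ[k] (1 : k) := by
  rw [coaction_apply, ← LinearMap.comp_apply, ← LinearMap.lTensor_comp,
    ← Coalgebra.lTensor_counit_comul]
  rfl

theorem quotComul_coassoc (x : evenQuotient 𝒜) :
    TensorProduct.assoc k _ _ _ (LinearMap.rTensor (evenQuotient 𝒜) (quotComul 𝒜).toLinearMap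
      (quotComul 𝒜 x)) =
      LinearMap.lTensor (evenQuotient 𝒜) (quotComul 𝒜).toLinearMap (quotComul 𝒜 x) := by
  obtain ⟨a, rfl⟩ := proj_surjective 𝒜 x
  have e : ∀ x : A ⊗[k] evenQuotient 𝒜, TensorProduct.assoc k _ _ _ (LinearMap.rTensor _
      (quotComul 𝒜).toLinearMap (LinearMap.rTensor _ (proj 𝒜).toLinearMap x)) =
      LinearMap.rTensor _ (proj 𝒜).toLinearMap (TensorProduct.assoc k _ _ _
        (LinearMap.rTensor _ (coaction 𝒜).toLinearMap x)) := by
    intro x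
    induction x with
    | zero => simp
    | add x y hx hy => simp only [map_add, hx, hy]
    | tmul a b =>
      simp only [LinearMap.rTensor_tmul, AlgHom.toLinearMap_apply, quotComul_coaction]
      induction coaction 𝒜 a with
      | zero => simp
      | add x y hx hy => simp only [map_add, TensorProduct.add_tmul, hx, hy]
      | tmul c d => rfl
  rw [quotComul_coaction, e, coassoc_of_proj, ← LinearMap.comp_apply,
    LinearMap.rTensor_comp_lTensor, ← LinearMap.comp_apply, LinearMap.lTensor_comp_rTensor]

theorem rTensor_quotCounit (x : evenQuotient 𝒜) :
    LinearMap.rTensor (evenQuotient 𝒜) (quotCounit 𝒜).toLinearMap (quotComul 𝒜 x) =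
      (1 : k) ⊗ₜ[k] x := by
  obtain ⟨a, rfl⟩ := proj_surjective 𝒜 x
  have e := congr(LinearMap.lTensor k (proj 𝒜).toLinearMap
    $(Coalgebra.rTensor_counit_comul (R := k) a))
  rw [← LinearMap.comp_apply, LinearMap.lTensor_comp_rTensor] at e
  rw [quotComul_proj, ← LinearMap.comp_apply, LinearMap.rTensor_comp_map]
  exact e

theorem lTensor_quotCounit (x : evenQuotient 𝒜) :
    LinearMap.lTensor (evenQuotient 𝒜) (quotCounit 𝒜).toLinearMap (quotComul 𝒜 x) =
      x ⊗ₜ[k] (1 : k) := by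
  obtain ⟨a, rfl⟩ := proj_surjective 𝒜 x
  rw [quotComul_coaction, ← LinearMap.comp_apply, LinearMap.lTensor_comp_rTensor,
    ← LinearMap.rTensor_comp_lTensor, LinearMap.comp_apply, coaction_counit]
  rfl

instance : Coalgebra k (evenQuotient 𝒜) where
  comul := (quotComul 𝒜).toLinearMap
  counit := (quotCounit 𝒜).toLinearMap
  coassoc := LinearMap.ext (quotComul_coassoc 𝒜)
  rTensor_counit_comp_comul := LinearMap.ext (rTensor_quotCounit 𝒜)
  lTensor_counit_comp_comul := LinearMap.ext (lTensor_quotCounit 𝒜)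

instance : Bialgebra k (evenQuotient 𝒜) :=
  Bialgebra.mk' k (evenQuotient 𝒜) (map_one (quotCounit 𝒜)) (map_mul (quotCounit 𝒜) _ _)
    (map_one (quotComul 𝒜)) (map_mul (quotComul 𝒜) _ _)

/-- The antipode of `A`. -/
def superAntipode : A →ₐ[k] A := (IsSuperAffineHopfAlgebra.exists_antipode (𝒜 := 𝒜)).choose

/-- The antipode of `B`. -/
def quotAntipode : evenQuotient 𝒜 →ₐ[k] evenQuotient 𝒜 :=
  Ideal.Quotient.liftₐ (superRadical 𝒜) ((proj 𝒜).comp (superAntipode 𝒜)) (by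
    intro a ha
    suffices h : superRadical 𝒜 ≤ RingHom.ker ((proj 𝒜).comp (superAntipode 𝒜)) from h ha
    exact Ideal.span_le.2 fun x hx => proj_odd 𝒜
      ((IsSuperAffineHopfAlgebra.exists_antipode (𝒜 := 𝒜)).choose_spec.1 1 x hx))

theorem mul_quotAntipode_left (x : evenQuotient 𝒜) :
    LinearMap.mul' k _ (LinearMap.rTensor _ (quotAntipode 𝒜).toLinearMap (quotComul 𝒜 x)) =
      algebraMap k _ (quotCounit 𝒜 x) := by
  obtain ⟨a, rfl⟩ := proj_surjective 𝒜 x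
  have e : ∀ x : A ⊗[k] A, LinearMap.mul' k _ (LinearMap.rTensor _ (quotAntipode 𝒜).toLinearMap
      (TensorProduct.map (proj 𝒜).toLinearMap (proj 𝒜).toLinearMap x)) = proj 𝒜
        (LinearMap.mul' k A (TensorProduct.map (superAntipode 𝒜).toLinearMap LinearMap.id x)) := by
    intro x
    induction x with
    | zero => simp
    | add x y hx hy => simp only [map_add, hx, hy]
    | tmul a b => rfl
  rw [quotComul_proj, e]
  exact congr(proj 𝒜 $(LinearMap.congr_fun
    (IsSuperAffineHopfAlgebra.exists_antipode (𝒜 := 𝒜)).choose_spec.2.1 a))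

theorem mul_quotAntipode_right (x : evenQuotient 𝒜) :
    LinearMap.mul' k _ (LinearMap.lTensor _ (quotAntipode 𝒜).toLinearMap (quotComul 𝒜 x)) =
      algebraMap k _ (quotCounit 𝒜 x) := by
  obtain ⟨a, rfl⟩ := proj_surjective 𝒜 x
  have e : ∀ x : A ⊗[k] A, LinearMap.mul' k _ (LinearMap.lTensor _ (quotAntipode 𝒜).toLinearMap
      (TensorProduct.map (proj 𝒜).toLinearMap (proj 𝒜).toLinearMap x)) = proj 𝒜
        (LinearMap.mul' k A (TensorProduct.map LinearMap.id (superAntipode 𝒜).toLinearMap x)) := by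
    intro x
    induction x with
    | zero => simp
    | add x y hx hy => simp only [map_add, hx, hy]
    | tmul a b => rfl
  rw [quotComul_proj, e]
  exact congr(proj 𝒜 $(LinearMap.congr_fun
    (IsSuperAffineHopfAlgebra.exists_antipode (𝒜 := 𝒜)).choose_spec.2.2 a))

instance : HopfAlgebra k (evenQuotient 𝒜) where
  antipode := (quotAntipode 𝒜).toLinearMap
  mul_antipode_rTensor_comul := LinearMap.ext (mul_quotAntipode_left 𝒜)
  mul_antipode_lTensor_comul := LinearMap.ext (mul_quotAntipode_right 𝒜)

end

section

variable {k A : Type*} [Field k] [Ring A] [Algebra k A] [Coalgebra k A]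
variable (𝒜 : ZMod 2 → Submodule k A) [GradedAlgebra 𝒜] [IsSuperAffineHopfAlgebra 𝒜]

section Graded

/-- The inclusion of `J^n` into `A`. -/
abbrev powIncl (n : ℕ) : ↥(superRadical 𝒜 ^ n) →ₗ[k] A :=
  (superRadical 𝒜 ^ n).subtype.restrictScalars k

theorem isComoduleHom_powIncl (n : ℕ) :
    IsComoduleHom (powCoaction 𝒜 n) (coaction 𝒜).toLinearMap (powIncl 𝒜 n) :=
  powTensor_powCoaction 𝒜 n

theorem isComoduleHom_grMk (n : ℕ) :
    IsComoduleHom (powCoaction 𝒜 n) (grCoaction 𝒜 n) ((grMk 𝒜 n).restrictScalars k) :=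
  fun _ => rfl

theorem isCoassoc_coaction : IsCoassoc (coaction 𝒜).toLinearMap := by
  intro a
  rw [LinearEquiv.eq_symm_apply]
  exact coassoc_of_proj 𝒜 a

theorem isCoassoc_powCoaction (n : ℕ) : IsCoassoc (powCoaction 𝒜 n) :=
  (isComoduleHom_powIncl 𝒜 n).isCoassoc_of_injective Subtype.val_injective (isCoassoc_coaction 𝒜)

theorem grMk_surjective (n : ℕ) : Function.Surjective (grMk 𝒜 n) := Submodule.mkQ_surjective _

theorem proj_smul (n : ℕ) (a : A) (m : gr 𝒜 n) : proj 𝒜 a • m = a • m := rfl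

instance (n : ℕ) : IsScalarTower k (evenQuotient 𝒜) (gr 𝒜 n) where
  smul_assoc c b m := by
    obtain ⟨a, rfl⟩ := proj_surjective 𝒜 b
    rw [← map_smul, proj_smul, proj_smul, smul_assoc]

theorem powCoaction_counit (n : ℕ) (x : ↥(superRadical 𝒜 ^ n)) :
    LinearMap.lTensor _ (Coalgebra.counit (R := k)) (powCoaction 𝒜 n x) = x ⊗ₜ[k] (1 : k) := by
  have hi : Function.Injective (LinearMap.rTensor k (powIncl 𝒜 n)) :=
    Module.Flat.rTensor_preserves_injective_linearMap _ Subtype.val_injective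
  apply hi
  rw [← (isComoduleHom_powIncl 𝒜 n).counit]
  exact coaction_counit 𝒜 _

/-- The action of `A ⊗ B` on `J^n ⊗ B`. -/
def powAct (n : ℕ) : A ⊗[k] evenQuotient 𝒜 →ₗ[k]
    ↥(superRadical 𝒜 ^ n) ⊗[k] evenQuotient 𝒜 →ₗ[k] ↥(superRadical 𝒜 ^ n) ⊗[k] evenQuotient 𝒜 :=
  TensorProduct.map₂ (Algebra.lsmul k k _).toLinearMap (LinearMap.mul k _)

theorem powTensor_powAct (n : ℕ) (x : A ⊗[k] evenQuotient 𝒜)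
    (u : ↥(superRadical 𝒜 ^ n) ⊗[k] evenQuotient 𝒜) :
    powTensor 𝒜 n (powAct 𝒜 n x u) = x * powTensor 𝒜 n u := by
  induction x with
  | zero => simp
  | add x y hx hy => simp only [map_add, LinearMap.add_apply, add_mul, hx, hy]
  | tmul a b =>
    induction u with
    | zero => simp
    | add x y hx hy => simp only [map_add, mul_add, hx, hy]
    | tmul c d => exact (Algebra.TensorProduct.tmul_mul_tmul a (c : A) b d).symm

theorem rTensor_grMk_powAct (n : ℕ) (x : A ⊗[k] evenQuotient 𝒜)
    (u : ↥(superRadical 𝒜 ^ n) ⊗[k] evenQuotient 𝒜) :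
    LinearMap.rTensor _ ((grMk 𝒜 n).restrictScalars k) (powAct 𝒜 n x u) =
      tensorAct (LinearMap.rTensor _ (proj 𝒜).toLinearMap x)
        (LinearMap.rTensor _ ((grMk 𝒜 n).restrictScalars k) u) := by
  induction x with
  | zero => simp
  | add x y hx hy => simp only [map_add, LinearMap.add_apply, hx, hy]
  | tmul a b =>
    induction u with
    | zero => simp
    | add x y hx hy => simp only [map_add, hx, hy]
    | tmul c d => rfl

theorem powCoaction_smul (n : ℕ) (a : A) (x : ↥(superRadical 𝒜 ^ n)) :
    powCoaction 𝒜 n (a • x) = powAct 𝒜 n (coaction 𝒜 a) (powCoaction 𝒜 n x) := by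
  apply powTensor_injective 𝒜 n
  rw [powTensor_powAct, powTensor_powCoaction, powTensor_powCoaction, Submodule.coe_smul,
    smul_eq_mul, map_mul]

theorem isHopfModule_gr (n : ℕ) : IsHopfModule (grCoaction 𝒜 n) where
  coassoc := (isComoduleHom_grMk 𝒜 n).isCoassoc_of_surjective (grMk_surjective 𝒜 n)
    (isCoassoc_powCoaction 𝒜 n)
  counit m := by
    obtain ⟨x, rfl⟩ := grMk_surjective 𝒜 n m
    have e := (isComoduleHom_grMk 𝒜 n).counit x
    rw [powCoaction_counit] at e
    exact e
  smul b m := by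
    obtain ⟨a, rfl⟩ := proj_surjective 𝒜 b
    obtain ⟨x, rfl⟩ := grMk_surjective 𝒜 n m
    have e := isComoduleHom_grMk 𝒜 n (a • x)
    rw [powCoaction_smul, rTensor_grMk_powAct, isComoduleHom_grMk] at e
    exact e.symm

/-- The inclusion of `J^(n+1)` into `J^n`. -/
def powSuccIncl (n : ℕ) : ↥(superRadical 𝒜 ^ (n + 1)) →ₗ[k] ↥(superRadical 𝒜 ^ n) :=
  (Submodule.inclusion (Ideal.pow_le_pow_right n.le_succ)).restrictScalars k

theorem isComoduleHom_powSuccIncl (n : ℕ) :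
    IsComoduleHom (powCoaction 𝒜 (n + 1)) (powCoaction 𝒜 n) (powSuccIncl 𝒜 n) := by
  intro x
  apply powTensor_injective 𝒜 n
  rw [powTensor_powCoaction, powTensor, ← LinearMap.comp_apply, ← LinearMap.rTensor_comp]
  exact powTensor_powCoaction 𝒜 (n + 1) x

theorem powSuccIncl_injective (n : ℕ) : Function.Injective (powSuccIncl 𝒜 n) :=
  Submodule.inclusion_injective (Ideal.pow_le_pow_right n.le_succ)

theorem exact_powSuccIncl_grMk (n : ℕ) :
    Function.Exact (powSuccIncl 𝒜 n) ((grMk 𝒜 n).restrictScalars k) := by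
  intro x
  refine (Submodule.Quotient.mk_eq_zero _).trans ⟨fun hx => ⟨⟨x, hx⟩, rfl⟩, ?_⟩
  rintro ⟨y, rfl⟩
  exact y.2

theorem isAcyclic_pow {N : ℕ} (hN : superRadical 𝒜 ^ N = ⊥) (n : ℕ) :
    IsAcyclic (powCoaction 𝒜 n) := by
  obtain ⟨d, hd⟩ : ∃ d, N ≤ n + d := ⟨N, Nat.le_add_left N n⟩
  induction d generalizing n with
  | zero =>
    have hs : Subsingleton ↥(superRadical 𝒜 ^ n) := by
      rw [Submodule.subsingleton_iff_eq_bot, eq_bot_iff, ← hN]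
      exact Ideal.pow_le_pow_right hd
    exact isAcyclic_of_subsingleton _
  | succ d ih =>
    exact IsAcyclic.extension (isComoduleHom_powSuccIncl 𝒜 n) (isComoduleHom_grMk 𝒜 n)
      (powSuccIncl_injective 𝒜 n) (exact_powSuccIncl_grMk 𝒜 n) (grMk_surjective 𝒜 n)
      (isCoassoc_powCoaction 𝒜 n) (ih (n + 1) (by omega)) (isHopfModule_gr 𝒜 n).isAcyclic

theorem mem_invariants {a : A} : a ∈ invariants 𝒜 ↔ coaction 𝒜 a = a ⊗ₜ[k] 1 := Iff.rfl

theorem powCoaction_eq_iff {n : ℕ} (x : ↥(superRadical 𝒜 ^ n)) :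
    powCoaction 𝒜 n x = x ⊗ₜ[k] 1 ↔ (x : A) ∈ invariants 𝒜 := by
  rw [mem_invariants, ← (powTensor_injective 𝒜 n).eq_iff, powTensor_powCoaction]
  rfl

theorem grMk_mem_grInvariants {n : ℕ} (x : ↥(superRadical 𝒜 ^ n)) (hx : (x : A) ∈ invariants 𝒜) :
    grMk 𝒜 n x ∈ grInvariants 𝒜 n := by
  have e := isComoduleHom_grMk 𝒜 n x
  rw [(powCoaction_eq_iff 𝒜 x).2 hx] at e
  exact e.symm

theorem exists_invariant_of_grInvariants {N : ℕ} (hN : superRadical 𝒜 ^ N = ⊥) {n : ℕ}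
    {m : gr 𝒜 n} (hm : m ∈ grInvariants 𝒜 n) :
    ∃ x : ↥(superRadical 𝒜 ^ n), (x : A) ∈ invariants 𝒜 ∧ grMk 𝒜 n x = m := by
  obtain ⟨x, hx, hxm⟩ := exists_invariant_lift (isComoduleHom_powSuccIncl 𝒜 n)
    (isComoduleHom_grMk 𝒜 n) (powSuccIncl_injective 𝒜 n) (exact_powSuccIncl_grMk 𝒜 n)
    (grMk_surjective 𝒜 n) (isCoassoc_powCoaction 𝒜 n) (isAcyclic_pow 𝒜 hN (n + 1)) hm
  exact ⟨x, (powCoaction_eq_iff 𝒜 x).1 hx, hxm⟩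

theorem span_grMk_eq_top {n : ℕ} {ι : Type*} [Finite ι] (z : ι → ↥(superRadical 𝒜 ^ n))
    (hz : superRadical 𝒜 ^ n ≤ Ideal.span (Set.range fun i => (z i : A))) :
    Submodule.span (evenQuotient 𝒜) (Set.range fun i => grMk 𝒜 n (z i)) = ⊤ := by
  have := Fintype.ofFinite ι
  rw [eq_top_iff]
  rintro m -
  obtain ⟨x, rfl⟩ := grMk_surjective 𝒜 n m
  obtain ⟨c, hc⟩ := (Submodule.mem_span_range_iff_exists_fun A).1 (hz x.2)
  have e : x = ∑ i, c i • z i := by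
    ext
    rw [← hc]
    simp
  rw [e, map_sum]
  refine Submodule.sum_mem _ fun i _ => ?_
  rw [map_smul, ← proj_smul]
  exact Submodule.smul_mem _ _ (Submodule.subset_span ⟨i, rfl⟩)

end Graded

end

section

variable {k A : Type*} [Field k] [Ring A] [Algebra k A] [Coalgebra k A]
variable (𝒜 : ZMod 2 → Submodule k A) [GradedAlgebra 𝒜]

section Parity

/-- The projection onto the even part. -/
abbrev evenPart : A →ₗ[k] A := GradedAlgebra.proj 𝒜 0

/-- The projection onto the odd part. -/
abbrev oddPart : A →ₗ[k] A := GradedAlgebra.proj 𝒜 1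

theorem evenPart_mem (a : A) : evenPart 𝒜 a ∈ 𝒜 0 := SetLike.coe_mem _

theorem oddPart_mem (a : A) : oddPart 𝒜 a ∈ 𝒜 1 := SetLike.coe_mem _

theorem evenPart_of_even {a : A} (ha : a ∈ 𝒜 0) : evenPart 𝒜 a = a :=
  DirectSum.decompose_of_mem_same 𝒜 ha

theorem oddPart_of_odd {a : A} (ha : a ∈ 𝒜 1) : oddPart 𝒜 a = a :=
  DirectSum.decompose_of_mem_same 𝒜 ha

theorem evenPart_of_odd {a : A} (ha : a ∈ 𝒜 1) : evenPart 𝒜 a = 0 :=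
  DirectSum.decompose_of_mem_ne 𝒜 ha one_ne_zero

theorem oddPart_of_even {a : A} (ha : a ∈ 𝒜 0) : oddPart 𝒜 a = 0 :=
  DirectSum.decompose_of_mem_ne 𝒜 ha zero_ne_one

variable [IsSuperAffineHopfAlgebra 𝒜]

theorem evenPart_add_oddPart (a : A) : evenPart 𝒜 a + oddPart 𝒜 a = a := by
  obtain ⟨b, hb, c, hc, rfl⟩ := even_add_odd 𝒜 a
  rw [map_add, map_add, evenPart_of_even 𝒜 hb, evenPart_of_odd 𝒜 hc, oddPart_of_even 𝒜 hb,
    oddPart_of_odd 𝒜 hc, add_zero, zero_add]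

theorem even_mul_even {a b : A} (ha : a ∈ 𝒜 0) (hb : b ∈ 𝒜 0) : a * b ∈ 𝒜 0 :=
  SetLike.mul_mem_graded ha hb

theorem even_mul_odd {a b : A} (ha : a ∈ 𝒜 0) (hb : b ∈ 𝒜 1) : a * b ∈ 𝒜 1 :=
  SetLike.mul_mem_graded ha hb

theorem odd_mul_even {a b : A} (ha : a ∈ 𝒜 1) (hb : b ∈ 𝒜 0) : a * b ∈ 𝒜 1 :=
  SetLike.mul_mem_graded ha hb

theorem odd_mul_odd {a b : A} (ha : a ∈ 𝒜 1) (hb : b ∈ 𝒜 1) : a * b ∈ 𝒜 0 :=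
  SetLike.mul_mem_graded ha hb

theorem oddPart_mul (a b : A) : oddPart 𝒜 (a * b) =
    evenPart 𝒜 a * oddPart 𝒜 b + oddPart 𝒜 a * evenPart 𝒜 b := by
  obtain ⟨a0, ha0, a1, ha1, rfl⟩ := even_add_odd 𝒜 a
  obtain ⟨b0, hb0, b1, hb1, rfl⟩ := even_add_odd 𝒜 b
  simp only [mul_add, add_mul, map_add, evenPart_of_even 𝒜 ha0, evenPart_of_even 𝒜 hb0,
    oddPart_of_odd 𝒜 ha1, oddPart_of_odd 𝒜 hb1, evenPart_of_odd 𝒜 ha1, evenPart_of_odd 𝒜 hb1,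
    oddPart_of_even 𝒜 ha0, oddPart_of_even 𝒜 hb0, oddPart_of_even 𝒜 (even_mul_even 𝒜 ha0 hb0),
    oddPart_of_odd 𝒜 (even_mul_odd 𝒜 ha0 hb1), oddPart_of_odd 𝒜 (odd_mul_even 𝒜 ha1 hb0),
    oddPart_of_even 𝒜 (odd_mul_odd 𝒜 ha1 hb1), add_zero, zero_add]
  abel

theorem evenPart_mul (a b : A) : evenPart 𝒜 (a * b) =
    evenPart 𝒜 a * evenPart 𝒜 b + oddPart 𝒜 a * oddPart 𝒜 b := by
  obtain ⟨a0, ha0, a1, ha1, rfl⟩ := even_add_odd 𝒜 a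
  obtain ⟨b0, hb0, b1, hb1, rfl⟩ := even_add_odd 𝒜 b
  simp only [mul_add, add_mul, map_add, evenPart_of_even 𝒜 ha0, evenPart_of_even 𝒜 hb0,
    oddPart_of_odd 𝒜 ha1, oddPart_of_odd 𝒜 hb1, evenPart_of_odd 𝒜 ha1, evenPart_of_odd 𝒜 hb1,
    oddPart_of_even 𝒜 ha0, oddPart_of_even 𝒜 hb0, evenPart_of_even 𝒜 (even_mul_even 𝒜 ha0 hb0),
    evenPart_of_odd 𝒜 (even_mul_odd 𝒜 ha0 hb1), evenPart_of_odd 𝒜 (odd_mul_even 𝒜 ha1 hb0),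
    evenPart_of_even 𝒜 (odd_mul_odd 𝒜 ha1 hb1), add_zero, zero_add]

theorem parity_apply (a : A) : parity 𝒜 a = evenPart 𝒜 a - oddPart 𝒜 a := rfl

theorem parity_even {a : A} (ha : a ∈ 𝒜 0) : parity 𝒜 a = a := by
  rw [parity_apply, evenPart_of_even 𝒜 ha, oddPart_of_even 𝒜 ha, sub_zero]

theorem parity_odd {a : A} (ha : a ∈ 𝒜 1) : parity 𝒜 a = -a := by
  rw [parity_apply, evenPart_of_odd 𝒜 ha, oddPart_of_odd 𝒜 ha, zero_sub]

theorem odd_anticomm {a b : A} (ha : a ∈ 𝒜 1) (hb : b ∈ 𝒜 1) : a * b = -(b * a) := by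
  have e := IsSuperAffineHopfAlgebra.superComm 1 1 a b ha hb
  rw [mul_one, uzpow_one] at e
  simpa using e

theorem odd_sq (h2 : (2 : k) ≠ 0) {a : A} (ha : a ∈ 𝒜 1) : a * a = 0 := by
  have e := odd_anticomm 𝒜 ha ha
  rw [eq_neg_iff_add_eq_zero, ← two_smul k] at e
  exact (smul_eq_zero.1 e).resolve_left h2

theorem odd_mul_comm {y : A} (hy : y ∈ 𝒜 1) (c : A) : y * c = parity 𝒜 c * y := by
  obtain ⟨a, ha, b, hb, rfl⟩ := even_add_odd 𝒜 c
  rw [map_add, parity_even 𝒜 ha, parity_odd 𝒜 hb, mul_add, add_mul, even_comm 𝒜 ha,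
    odd_anticomm 𝒜 hy hb, neg_mul]

theorem isAnticommuting_of_odd (h2 : (2 : k) ≠ 0) {s : ℕ} {y : Fin s → A} (hy : ∀ i, y i ∈ 𝒜 1) :
    IsAnticommuting y :=
  ⟨fun i => odd_sq 𝒜 h2 (hy i), fun i j => odd_anticomm 𝒜 (hy i) (hy j)⟩

theorem evenPart_mem_sq {x : A} (hx : x ∈ superRadical 𝒜) : evenPart 𝒜 x ∈ superRadical 𝒜 ^ 2 := by
  induction hx using Submodule.span_induction with
  | mem x hx => rw [evenPart_of_odd 𝒜 hx]; exact Ideal.zero_mem _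
  | zero => rw [map_zero]; exact Ideal.zero_mem _
  | add x y _ _ hx hy => rw [map_add]; exact Ideal.add_mem _ hx hy
  | smul a x _ hx =>
    rw [smul_eq_mul, evenPart_mul]
    refine Ideal.add_mem _ (Ideal.mul_mem_left _ _ hx) ?_
    rw [Ideal.IsTwoSided.pow_succ, Submodule.pow_one]
    exact Ideal.mul_mem_mul (odd_mem 𝒜 (oddPart_mem 𝒜 a)) (odd_mem 𝒜 (oddPart_mem 𝒜 x))

theorem coaction_oddPart (a : A) : coaction 𝒜 (oddPart 𝒜 a) =
    LinearMap.rTensor (evenQuotient 𝒜) (oddPart 𝒜) (coaction 𝒜 a) := by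
  have key : ∀ (i : ZMod 2) (z : A ⊗[k] A), z ∈ tensorPart 𝒜 i →
      ∃ t : ↥(𝒜 i) ⊗[k] evenQuotient 𝒜, LinearMap.rTensor _ (𝒜 i).subtype t =
        LinearMap.lTensor A (proj 𝒜).toLinearMap z := by
    intro i z hz
    suffices h : tensorPart 𝒜 i ≤ (LinearMap.range (LinearMap.rTensor (evenQuotient 𝒜)
      (𝒜 i).subtype)).comap (LinearMap.lTensor A (proj 𝒜).toLinearMap) from h hz
    refine iSup_le fun p => ?_
    rintro _ ⟨t, rfl⟩
    induction t with
    | zero => simp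
    | add t u ht hu => rw [map_add]; exact Submodule.add_mem _ ht hu
    | tmul a b =>
      rw [TensorProduct.map_tmul, Submodule.mem_comap, LinearMap.lTensor_tmul]
      by_cases h : p = i
      · subst h
        exact ⟨a ⊗ₜ _, rfl⟩
      · have h1 : i - p = 1 := (eq_zero_or_one (i - p)).resolve_left
          (fun e => h (sub_eq_zero.1 e).symm)
        have hb : (proj 𝒜).toLinearMap ((𝒜 (i - p)).subtype b) = 0 :=
          proj_odd 𝒜 (h1 ▸ b.2)
        rw [hb, TensorProduct.tmul_zero]
        exact Submodule.zero_mem _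
  obtain ⟨a, ha, b, hb, rfl⟩ := even_add_odd 𝒜 a
  obtain ⟨t, ht⟩ := key 0 _ (IsSuperAffineHopfAlgebra.comul_mem 0 a ha)
  obtain ⟨u, hu⟩ := key 1 _ (IsSuperAffineHopfAlgebra.comul_mem 1 b hb)
  have e0 : oddPart 𝒜 ∘ₗ (𝒜 0).subtype = 0 := LinearMap.ext fun x => oddPart_of_even 𝒜 x.2
  have e1 : oddPart 𝒜 ∘ₗ (𝒜 1).subtype = (𝒜 1).subtype :=
    LinearMap.ext fun x => oddPart_of_odd 𝒜 x.2
  rw [map_add, map_add, map_add, oddPart_of_even 𝒜 ha, oddPart_of_odd 𝒜 hb, map_zero, zero_add,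
    map_add, coaction_apply 𝒜 a, coaction_apply 𝒜 b, ← ht, ← hu, ← LinearMap.comp_apply,
    ← LinearMap.comp_apply, ← LinearMap.rTensor_comp, ← LinearMap.rTensor_comp, e0, e1,
    LinearMap.rTensor_zero, LinearMap.zero_apply, zero_add]

theorem oddPart_invariant {a : A} (ha : a ∈ invariants 𝒜) : oddPart 𝒜 a ∈ invariants 𝒜 := by
  rw [mem_invariants] at ha ⊢
  rw [coaction_oddPart, ha, LinearMap.rTensor_tmul]

end Parity

section Basis

variable {K M ι : Type*} [Field K] [AddCommGroup M] [Module K M] {W : Submodule K M}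

theorem linearIndependent_coe_basis (b : Module.Basis ι K W) :
    LinearIndependent K fun i => (b i : M) :=
  b.linearIndependent.map' _ (Submodule.ker_subtype _)

theorem span_coe_basis (b : Module.Basis ι K W) :
    Submodule.span K (Set.range fun i => (b i : M)) = W := by
  have h := congr(Submodule.map W.subtype $(b.span_eq))
  rwa [Submodule.map_span, ← Set.range_comp, Submodule.map_top, Submodule.range_subtype] at h

end Basis

section Finiteness

variable [IsSuperAffineHopfAlgebra 𝒜]

theorem exists_odd_generators : ∃ (m : ℕ) (y : Fin m → A), (∀ i, y i ∈ 𝒜 1) ∧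
    superRadical 𝒜 ≤ Ideal.span (Set.range y) := by
  classical
  obtain ⟨S, hS⟩ := (IsSuperAffineHopfAlgebra.finiteType (𝒜 := 𝒜)).out
  let T := S.image (oddPart 𝒜)
  refine ⟨T.card, fun i => (T.equivFin.symm i : A), fun i => ?_, ?_⟩
  · obtain ⟨a, -, e⟩ := Finset.mem_image.1 (T.equivFin.symm i).2
    have h := oddPart_mem 𝒜 a
    rw [e] at h
    exact h
  · have hr : (Set.range fun i => (T.equivFin.symm i : A)) = T := by
      ext x
      refine ⟨?_, fun hx => ⟨T.equivFin ⟨x, hx⟩, by simp⟩⟩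
      rintro ⟨i, rfl⟩
      exact (T.equivFin.symm i).2
    rw [hr]
    have h : ∀ a, oddPart 𝒜 a ∈ Ideal.span (T : Set A) := by
      intro a
      have ha : a ∈ Algebra.adjoin k (S : Set A) := hS ▸ Algebra.mem_top
      induction ha using Algebra.adjoin_induction with
      | mem x hx => exact Ideal.subset_span (Finset.mem_image_of_mem _ hx)
      | algebraMap r =>
        rw [oddPart_of_even 𝒜 (SetLike.algebraMap_mem_graded 𝒜 r)]
        exact Ideal.zero_mem _
      | add x y _ _ hx hy => rw [map_add]; exact Ideal.add_mem _ hx hy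
      | mul x y _ _ hx hy =>
        rw [oddPart_mul, ← even_comm 𝒜 (evenPart_mem 𝒜 y)]
        exact Ideal.add_mem _ (Ideal.mul_mem_left _ _ hy) (Ideal.mul_mem_left _ _ hx)
    refine Ideal.span_le.2 fun x hx => ?_
    rw [← oddPart_of_odd 𝒜 hx]
    exact h x

theorem exists_superRadical_pow_eq_bot (h2 : (2 : k) ≠ 0) : ∃ N, superRadical 𝒜 ^ N = ⊥ := by
  obtain ⟨m, y, hy, hJ⟩ := exists_odd_generators 𝒜
  exact ⟨m + 1, (isAnticommuting_of_odd 𝒜 h2 hy).pow_eq_bot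
    (fun i c => ⟨_, odd_mul_comm 𝒜 (hy i) c⟩) hJ m.lt_succ_self⟩

instance : Nontrivial (evenQuotient 𝒜) := (quotCounit 𝒜).toRingHom.domain_nontrivial

theorem finite_gr_one : Module.Finite (evenQuotient 𝒜) (gr 𝒜 1) := by
  obtain ⟨m, y, hy, hJ⟩ := exists_odd_generators 𝒜
  have h := span_grMk_eq_top 𝒜 (fun i => ⟨y i, odd_mem_pow_one 𝒜 (hy i)⟩)
    ((Submodule.pow_one _).le.trans hJ)
  exact ⟨⟨(Set.finite_range _).toFinset, by rw [Set.Finite.coe_toFinset, h]⟩⟩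

theorem finite_grInvariants_one : Module.Finite k (grInvariants 𝒜 1) := by
  have := finite_gr_one 𝒜
  let b := Module.Basis.ofVectorSpace k (grInvariants 𝒜 1)
  have := ((isHopfModule_gr 𝒜 1).linearIndependent (fun i => (b i).2)
    (linearIndependent_coe_basis b)).finite
  exact Module.Finite.of_basis b

theorem exists_isOddCoordinates (h2 : (2 : k) ≠ 0) :
    ∃ (r : ℕ) (θ : Fin r → A), IsOddCoordinates 𝒜 θ := by
  obtain ⟨N, hN⟩ := exists_superRadical_pow_eq_bot 𝒜 h2
  have := finite_grInvariants_one 𝒜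
  let b := Module.finBasis k (grInvariants 𝒜 1)
  choose x hx hxb using fun i => exists_invariant_of_grInvariants 𝒜 hN (b i).2
  have e : ∀ i, grMk 𝒜 1 ⟨oddPart 𝒜 (x i), odd_mem_pow_one 𝒜 (oddPart_mem 𝒜 (x i))⟩ = b i := by
    intro i
    rw [← hxb i, eq_comm, ← sub_eq_zero, ← map_sub]
    refine (Submodule.Quotient.mk_eq_zero _).2 ?_
    change (x i : A) - oddPart 𝒜 (x i) ∈ superRadical 𝒜 ^ 2
    rw [← eq_sub_of_add_eq (evenPart_add_oddPart 𝒜 (x i : A))]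
    apply evenPart_mem_sq
    exact (Submodule.pow_one (superRadical 𝒜)).le (x i).2
  refine ⟨_, fun i => oddPart 𝒜 (x i), fun i => oddPart_mem 𝒜 _,
    fun i => oddPart_invariant 𝒜 (hx i), ?_, ?_⟩
  · simp only [e]
    exact linearIndependent_coe_basis b
  · simp only [e]
    exact span_coe_basis b

end Finiteness

end

section

variable {k A : Type*} [Field k] [Ring A] [Algebra k A] [Coalgebra k A]
variable (𝒜 : ZMod 2 → Submodule k A) [GradedAlgebra 𝒜] [IsSuperAffineHopfAlgebra 𝒜]

section ParityMul

theorem parity_parity (a : A) : parity 𝒜 (parity 𝒜 a) = a := by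
  obtain ⟨b, hb, c, hc, rfl⟩ := even_add_odd 𝒜 a
  rw [map_add, map_add, parity_even 𝒜 hb, parity_odd 𝒜 hc, map_neg, parity_even 𝒜 hb,
    parity_odd 𝒜 hc, neg_neg]

theorem parity_mul (a b : A) : parity 𝒜 (a * b) = parity 𝒜 a * parity 𝒜 b := by
  simp only [parity_apply, evenPart_mul, oddPart_mul, mul_sub, sub_mul]
  abel

theorem parity_mem {i : ZMod 2} {a : A} (ha : a ∈ 𝒜 i) : parity 𝒜 a ∈ 𝒜 i := by
  rcases eq_zero_or_one i with rfl | rfl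
  · rwa [parity_even 𝒜 ha]
  · rw [parity_odd 𝒜 ha]
    exact Submodule.neg_mem _ ha

theorem counitHom_parity (a : A) : counitHom 𝒜 (parity 𝒜 a) = counitHom 𝒜 a := by
  obtain ⟨b, hb, c, hc, rfl⟩ := even_add_odd 𝒜 a
  rw [map_add, parity_even 𝒜 hb, parity_odd 𝒜 hc, map_add, map_add, map_neg,
    counitHom_odd 𝒜 hc, neg_zero]

theorem counitHom_evenPart (a : A) : counitHom 𝒜 (evenPart 𝒜 a) = counitHom 𝒜 a := by
  conv_rhs => rw [← evenPart_add_oddPart 𝒜 a, map_add, counitHom_odd 𝒜 (oddPart_mem 𝒜 a), add_zero]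

theorem comul_parity (a : A) : Coalgebra.comul (R := k) (parity 𝒜 a) =
    TensorProduct.map (parity 𝒜) (parity 𝒜) (Coalgebra.comul a) := by
  have h0 : ∀ z ∈ tensorPart 𝒜 0, TensorProduct.map (parity 𝒜) (parity 𝒜) z = z := by
    intro z hz
    suffices h : tensorPart 𝒜 0 ≤
      LinearMap.eqLocus (TensorProduct.map (parity 𝒜) (parity 𝒜)) LinearMap.id from h hz
    refine iSup_le fun p => ?_
    rintro _ ⟨t, rfl⟩
    induction t with
    | zero => simp
    | add t u ht hu => rw [map_add]; exact Submodule.add_mem _ ht hu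
    | tmul a b =>
      obtain ⟨a, ha⟩ := a
      obtain ⟨b, hb⟩ := b
      rw [LinearMap.mem_eqLocus]
      simp only [TensorProduct.map_tmul, Submodule.subtype_apply, LinearMap.id_apply]
      rcases eq_zero_or_one p with rfl | rfl
      · rw [parity_even 𝒜 ha, parity_even 𝒜 hb]
      · rw [parity_odd 𝒜 ha, parity_odd 𝒜 hb, TensorProduct.neg_tmul, TensorProduct.tmul_neg,
          neg_neg]
  have h1 : ∀ z ∈ tensorPart 𝒜 1, TensorProduct.map (parity 𝒜) (parity 𝒜) z = -z := by
    intro z hz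
    suffices h : tensorPart 𝒜 1 ≤
      LinearMap.eqLocus (TensorProduct.map (parity 𝒜) (parity 𝒜)) (-LinearMap.id) from h hz
    refine iSup_le fun p => ?_
    rintro _ ⟨t, rfl⟩
    induction t with
    | zero => simp
    | add t u ht hu => rw [map_add]; exact Submodule.add_mem _ ht hu
    | tmul a b =>
      obtain ⟨a, ha⟩ := a
      obtain ⟨b, hb⟩ := b
      rw [LinearMap.mem_eqLocus]
      simp only [TensorProduct.map_tmul, Submodule.subtype_apply, LinearMap.neg_apply,
        LinearMap.id_apply]
      rcases eq_zero_or_one p with rfl | rfl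
      · rw [parity_even 𝒜 ha, parity_odd 𝒜 hb, TensorProduct.tmul_neg]
      · rw [parity_odd 𝒜 ha, parity_even 𝒜 hb, TensorProduct.neg_tmul]
  obtain ⟨b, hb, c, hc, rfl⟩ := even_add_odd 𝒜 a
  rw [map_add, map_add, map_add, map_add, parity_even 𝒜 hb, parity_odd 𝒜 hc,
    h0 _ (IsSuperAffineHopfAlgebra.comul_mem 0 b hb),
    h1 _ (IsSuperAffineHopfAlgebra.comul_mem 1 c hc), map_neg]

open GradedTensorProduct in
theorem of_tmul_mul_of_even (a c d : A) {b : A} (hb : b ∈ 𝒜 0) :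
    of k 𝒜 𝒜 (a ⊗ₜ b) * of k 𝒜 𝒜 (c ⊗ₜ d) = of k 𝒜 𝒜 ((a * c) ⊗ₜ (b * d)) := by
  have key : ∀ (i : ZMod 2) (c : A), c ∈ 𝒜 i →
      of k 𝒜 𝒜 (a ⊗ₜ b) * of k 𝒜 𝒜 (c ⊗ₜ d) = of k 𝒜 𝒜 ((a * c) ⊗ₜ (b * d)) :=
    fun i c hc => tmul_zero_coe_mul_coe_tmul 𝒜 𝒜 a ⟨b, hb⟩ ⟨c, hc⟩ d
  obtain ⟨c0, h0, c1, h1, rfl⟩ := even_add_odd 𝒜 c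
  rw [TensorProduct.add_tmul, map_add, mul_add, key 0 c0 h0, key 1 c1 h1, mul_add,
    TensorProduct.add_tmul, map_add]

open GradedTensorProduct in
theorem of_tmul_mul_of_odd (a c d : A) {b : A} (hb : b ∈ 𝒜 1) :
    of k 𝒜 𝒜 (a ⊗ₜ b) * of k 𝒜 𝒜 (c ⊗ₜ d) = of k 𝒜 𝒜 ((a * parity 𝒜 c) ⊗ₜ (b * d)) := by
  obtain ⟨c0, h0, c1, h1, rfl⟩ := even_add_odd 𝒜 c
  have e0 : of k 𝒜 𝒜 (a ⊗ₜ b) * of k 𝒜 𝒜 (c0 ⊗ₜ d) = of k 𝒜 𝒜 ((a * c0) ⊗ₜ (b * d)) :=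
    tmul_coe_mul_zero_coe_tmul 𝒜 𝒜 a ⟨b, hb⟩ ⟨c0, h0⟩ d
  have e1 : of k 𝒜 𝒜 (a ⊗ₜ b) * of k 𝒜 𝒜 (c1 ⊗ₜ d) = -of k 𝒜 𝒜 ((a * c1) ⊗ₜ (b * d)) := by
    refine (tmul_coe_mul_coe_tmul 𝒜 𝒜 a ⟨b, hb⟩ ⟨c1, h1⟩ d).trans ?_
    rw [mul_one, uzpow_one, Units.neg_smul, one_smul]
  rw [TensorProduct.add_tmul, map_add, mul_add, e0, e1, map_add, parity_even 𝒜 h0,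
    parity_odd 𝒜 h1, mul_add, TensorProduct.add_tmul, map_add, mul_neg, TensorProduct.neg_tmul,
    map_neg]

end ParityMul

section Derivation

/-- The odd `k`-derivations of `A` at the counit. -/
structure IsOddPointDerivation (δ : A →ₗ[k] k) : Prop where
  even : ∀ a ∈ 𝒜 0, δ a = 0
  mul : ∀ a b, δ (a * b) = δ a * counitHom 𝒜 b + counitHom 𝒜 a * δ b

/-- The map `a ⊗ b ↦ δ b • parity a`. -/
def contract (δ : A →ₗ[k] k) : A ⊗[k] A →ₗ[k] A :=
  (TensorProduct.rid k A).toLinearMap ∘ₗ TensorProduct.map (parity 𝒜) δ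

theorem contract_tmul (δ : A →ₗ[k] k) (a b : A) :
    contract 𝒜 δ (a ⊗ₜ b) = δ b • parity 𝒜 a := by
  simp [contract]

/-- The left-invariant superderivation with value `δ` at the counit. -/
def invariantDerivation (δ : A →ₗ[k] k) : Module.End k A := contract 𝒜 δ ∘ₗ Coalgebra.comul

theorem counitHom_contract (δ : A →ₗ[k] k) (z : A ⊗[k] A) :
    counitHom 𝒜 (contract 𝒜 δ z) =
      δ (TensorProduct.lid k A (LinearMap.rTensor A Coalgebra.counit z)) := by
  induction z with
  | zero => simp
  | add x y hx hy => simp only [map_add, hx, hy]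
  | tmul a b =>
    rw [contract_tmul, map_smul, counitHom_parity, LinearMap.rTensor_tmul, TensorProduct.lid_tmul,
      map_smul, smul_eq_mul, smul_eq_mul, mul_comm]
    rfl

theorem counitHom_invariantDerivation (δ : A →ₗ[k] k) (a : A) :
    counitHom 𝒜 (invariantDerivation 𝒜 δ a) = δ a := by
  rw [invariantDerivation, LinearMap.comp_apply, counitHom_contract,
    Coalgebra.rTensor_counit_comul, TensorProduct.lid_tmul, one_smul]

variable {𝒜} {δ : A →ₗ[k] k} (hδ : IsOddPointDerivation 𝒜 δ)

include hδ

open GradedTensorProduct in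
theorem IsOddPointDerivation.contract_mul (x y : A ⊗[k] A) :
    contract 𝒜 δ ((of k 𝒜 𝒜).symm (of k 𝒜 𝒜 x * of k 𝒜 𝒜 y)) =
      contract 𝒜 δ x * TensorProduct.rid k A (LinearMap.lTensor A Coalgebra.counit y) +
        parity 𝒜 (TensorProduct.rid k A (LinearMap.lTensor A Coalgebra.counit x)) *
          contract 𝒜 δ y := by
  induction x with
  | zero => simp
  | add x x' hx hx' =>
    simp only [map_add, add_mul, hx, hx']
    abel
  | tmul a b =>
    induction y with
    | zero => simp
    | add y y' hy hy' =>
      simp only [map_add, mul_add, hy, hy']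
      abel
    | tmul c d =>
      have hε : ∀ x : A, Coalgebra.counit (R := k) x = counitHom 𝒜 x := fun _ => rfl
      obtain ⟨b0, h0, b1, h1, rfl⟩ := even_add_odd 𝒜 b
      rw [TensorProduct.tmul_add, map_add, add_mul, of_tmul_mul_of_even 𝒜 a c d h0,
        of_tmul_mul_of_odd 𝒜 a c d h1, ← map_add, of_symm_of]
      simp only [map_add, contract_tmul, LinearMap.lTensor_tmul, TensorProduct.rid_tmul, hε,
        hδ.mul, hδ.even b0 h0, counitHom_odd 𝒜 h1, parity_mul, parity_parity]
      simp only [zero_mul, zero_add, add_zero, zero_smul, map_zero, map_smul, smul_mul_assoc,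
        mul_smul_comm]
      module

theorem IsOddPointDerivation.mem_lieAlg : invariantDerivation 𝒜 δ ∈ lieAlg 𝒜 1 := by
  have hp : parity 𝒜 ^ (1 : ZMod 2).val = parity 𝒜 := pow_one _
  refine ⟨fun i a ha => ?_, fun a b => ?_, ?_⟩
  · suffices h : tensorPart 𝒜 i ≤ (𝒜 (i + 1)).comap (contract 𝒜 δ) from
      h (IsSuperAffineHopfAlgebra.comul_mem i a ha)
    refine iSup_le fun p => ?_
    rintro _ ⟨t, rfl⟩
    induction t with
    | zero => simp
    | add t u ht hu => rw [map_add]; exact Submodule.add_mem _ ht hu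
    | tmul a b =>
      obtain ⟨a, ha⟩ := a
      obtain ⟨b, hb⟩ := b
      simp only [TensorProduct.map_tmul, Submodule.subtype_apply, Submodule.mem_comap,
        contract_tmul]
      by_cases h : p = i
      · subst h
        rw [sub_self] at hb
        rw [hδ.even b hb, zero_smul]
        exact Submodule.zero_mem _
      · have h1 : p = i + 1 := (by decide : ∀ p i : ZMod 2, p ≠ i → p = i + 1) p i h
        exact Submodule.smul_mem _ _ (h1 ▸ parity_mem 𝒜 ha)
  · rw [hp]
    have e : Coalgebra.comul (R := k) (a * b) = (GradedTensorProduct.of k 𝒜 𝒜).symm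
        (GradedTensorProduct.of k 𝒜 𝒜 (Coalgebra.comul a) *
          GradedTensorProduct.of k 𝒜 𝒜 (Coalgebra.comul b)) := by
      rw [LinearEquiv.eq_symm_apply]
      exact IsSuperAffineHopfAlgebra.comul_mul a b
    simp only [invariantDerivation, LinearMap.comp_apply]
    rw [e, hδ.contract_mul, Coalgebra.lTensor_counit_comul, Coalgebra.lTensor_counit_comul,
      TensorProduct.rid_tmul, TensorProduct.rid_tmul, one_smul, one_smul]
  · rw [hp]
    ext a
    have e1 : ∀ z : A ⊗[k] A, Coalgebra.comul (R := k) (contract 𝒜 δ z) =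
        TensorProduct.map (parity 𝒜) (contract 𝒜 δ) (TensorProduct.assoc k A A A
          (LinearMap.rTensor A Coalgebra.comul z)) := by
      intro z
      induction z with
      | zero => simp
      | add x y hx hy => simp only [map_add, hx, hy]
      | tmul a b =>
        rw [contract_tmul, map_smul, comul_parity, LinearMap.rTensor_tmul]
        induction Coalgebra.comul (R := k) a with
        | zero => simp
        | add x y hx hy => simp only [map_add, smul_add, TensorProduct.add_tmul, hx, hy]
        | tmul c d =>
          rw [TensorProduct.map_tmul, TensorProduct.assoc_tmul, TensorProduct.map_tmul,
            contract_tmul, TensorProduct.tmul_smul]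
    rw [LinearMap.comp_apply, LinearMap.comp_apply, invariantDerivation, LinearMap.comp_apply, e1,
      Coalgebra.coassoc_apply, ← LinearMap.comp_apply, LinearMap.map_comp_lTensor]

end Derivation

section LieAlg

variable {𝒜} {D : Module.End k A} (hD : D ∈ lieAlg 𝒜 1)

include hD

theorem lieAlg_one_mul (a b : A) : D (a * b) = D a * b + parity 𝒜 a * D b := hD.2.1 a b

theorem counitHom_lieAlg_one_of_even {a : A} (ha : a ∈ 𝒜 0) : counitHom 𝒜 (D a) = 0 :=
  counitHom_odd 𝒜 (hD.1 0 a ha)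

theorem lieAlg_one_eq_zero (h : ∀ a, counitHom 𝒜 (D a) = 0) : D = 0 := by
  ext a
  have e := congr(TensorProduct.rid k A (LinearMap.lTensor A Coalgebra.counit
    ($(hD.2.2) a)))
  have h0 : Coalgebra.counit ∘ₗ D = (0 : A →ₗ[k] k) := LinearMap.ext h
  rw [LinearMap.comp_apply, Coalgebra.lTensor_counit_comul, LinearMap.comp_apply,
    ← LinearMap.comp_apply, LinearMap.lTensor_comp_map, h0, TensorProduct.map_zero_right,
    LinearMap.zero_apply, map_zero, TensorProduct.rid_tmul, one_smul] at e
  exact e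

end LieAlg

end

section

variable {k A : Type*} [Field k] [Ring A] [Algebra k A] [Coalgebra k A]
variable {𝒜 : ZMod 2 → Submodule k A} [GradedAlgebra 𝒜] [IsSuperAffineHopfAlgebra 𝒜]

section Pairing

/-- The odd part of an element of `A`, as an element of `J`. -/
def oddPow (𝒜 : ZMod 2 → Submodule k A) [GradedAlgebra 𝒜] [IsSuperAffineHopfAlgebra 𝒜] :
    A →ₗ[k] ↥(superRadical 𝒜 ^ 1) where
  toFun a := ⟨oddPart 𝒜 a, odd_mem_pow_one 𝒜 (oddPart_mem 𝒜 a)⟩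
  map_add' a b := Subtype.ext (map_add _ a b)
  map_smul' c a := Subtype.ext (map_smul _ c a)

theorem oddPow_mul (a b : A) :
    oddPow 𝒜 (a * b) = evenPart 𝒜 a • oddPow 𝒜 b + evenPart 𝒜 b • oddPow 𝒜 a := by
  apply Subtype.ext
  refine (oddPart_mul 𝒜 a b).trans ?_
  rw [← even_comm 𝒜 (evenPart_mem 𝒜 b)]
  rfl

theorem quotCounit_proj_even (a : A) : quotCounit 𝒜 (proj 𝒜 (evenPart 𝒜 a)) = counitHom 𝒜 a :=
  counitHom_evenPart 𝒜 a

/-- The point derivation given by a `B`-linear form on `J / J^2`. -/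
def pointDerivation (f : gr 𝒜 1 →ₗ[evenQuotient 𝒜] evenQuotient 𝒜) : A →ₗ[k] k :=
  (quotCounit 𝒜).toLinearMap ∘ₗ f.restrictScalars k ∘ₗ (grMk 𝒜 1).restrictScalars k ∘ₗ oddPow 𝒜

theorem pointDerivation_apply (f : gr 𝒜 1 →ₗ[evenQuotient 𝒜] evenQuotient 𝒜) (a : A) :
    pointDerivation f a = quotCounit 𝒜 (f (grMk 𝒜 1 (oddPow 𝒜 a))) := rfl

theorem isOddPointDerivation (f : gr 𝒜 1 →ₗ[evenQuotient 𝒜] evenQuotient 𝒜) :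
    IsOddPointDerivation 𝒜 (pointDerivation f) where
  even a ha := by
    have h : oddPow 𝒜 a = 0 := Subtype.ext (oddPart_of_even 𝒜 ha)
    rw [pointDerivation_apply, h, map_zero, map_zero, map_zero]
  mul a b := by
    rw [pointDerivation_apply, oddPow_mul, map_add, map_smul, map_smul, ← proj_smul, ← proj_smul,
      map_add, map_smul, map_smul, smul_eq_mul, smul_eq_mul, map_add, map_mul, map_mul,
      quotCounit_proj_even, quotCounit_proj_even, pointDerivation_apply, pointDerivation_apply]
    ring

/-- The values at the counit of the derivatives of the coordinates. -/
def evalLie (𝒜 : ZMod 2 → Submodule k A) [GradedAlgebra 𝒜] [IsSuperAffineHopfAlgebra 𝒜] {s : ℕ}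
    (θ : Fin s → A) : lieAlg 𝒜 1 →ₗ[k] (Fin s → k) where
  toFun D i := counitHom 𝒜 (D.1 (θ i))
  map_add' D E := by
    ext i
    simp
  map_smul' c D := by
    ext i
    simp

end Pairing

namespace IsOddCoordinates

variable {s : ℕ} {θ : Fin s → A} (hθ : IsOddCoordinates 𝒜 θ)

include hθ

theorem linearIndependent_quot : LinearIndependent (evenQuotient 𝒜)
    fun i => grMk 𝒜 1 ⟨θ i, odd_mem_pow_one 𝒜 (hθ.odd i)⟩ :=
  (isHopfModule_gr 𝒜 1).linearIndependent
    (fun i => grMk_mem_grInvariants 𝒜 _ (hθ.invariant i)) hθ.linearIndependent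

theorem span_quot : Submodule.span (evenQuotient 𝒜)
    (Set.range fun i => grMk 𝒜 1 ⟨θ i, odd_mem_pow_one 𝒜 (hθ.odd i)⟩) = ⊤ := by
  rw [eq_top_iff]
  rintro m -
  refine (Submodule.span_le.2 fun v hv => ?_) ((isHopfModule_gr 𝒜 1).mem_span_invariants m)
  have h : v ∈ grInvariants 𝒜 1 := hv
  rw [← hθ.span_eq] at h
  exact Submodule.span_le_restrictScalars k (evenQuotient 𝒜) _ h

theorem superRadical_le_sup : superRadical 𝒜 ≤ Ideal.span (Set.range θ) ⊔ superRadical 𝒜 ^ 2 := by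
  intro x hx
  let x' : ↥(superRadical 𝒜 ^ 1) := ⟨x, (Submodule.pow_one (superRadical 𝒜)).ge hx⟩
  have h : grMk 𝒜 1 x' ∈ Submodule.span (evenQuotient 𝒜)
      (Set.range fun i => grMk 𝒜 1 ⟨θ i, odd_mem_pow_one 𝒜 (hθ.odd i)⟩) := by
    rw [hθ.span_quot]
    trivial
  obtain ⟨b, hb⟩ := (Submodule.mem_span_range_iff_exists_fun _).1 h
  choose c hc using fun i => proj_surjective 𝒜 (b i)
  have e : grMk 𝒜 1 (x' - ∑ i, c i • ⟨θ i, odd_mem_pow_one 𝒜 (hθ.odd i)⟩) = 0 := by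
    rw [map_sub, map_sum, sub_eq_zero, ← hb]
    refine Finset.sum_congr rfl fun i _ => ?_
    rw [map_smul, ← hc, proj_smul]
  have e' := (Submodule.Quotient.mk_eq_zero _).1 e
  have e2 : x - ∑ i, c i * θ i ∈ superRadical 𝒜 ^ 2 := by
    have := Submodule.mem_comap.1 e'
    simpa using this
  rw [← add_sub_cancel (∑ i, c i * θ i) x]
  exact Submodule.add_mem_sup (Ideal.sum_mem _ fun i _ =>
    Ideal.mul_mem_left _ _ (Ideal.subset_span ⟨i, rfl⟩)) e2

theorem superRadical_le (h2 : (2 : k) ≠ 0) : superRadical 𝒜 ≤ Ideal.span (Set.range θ) := by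
  have h : ∀ n, superRadical 𝒜 ≤ Ideal.span (Set.range θ) ⊔ superRadical 𝒜 ^ (n + 1) := by
    intro n
    induction n with
    | zero => rw [zero_add, Submodule.pow_one]; exact le_sup_right
    | succ n ih =>
      refine ih.trans (sup_le le_sup_left ?_)
      rw [Submodule.pow_succ, Ideal.mul_le]
      intro x hx y hy
      obtain ⟨a, ha, b, hb, rfl⟩ := Submodule.mem_sup.1 (hθ.superRadical_le_sup hy)
      rw [mul_add]
      refine Submodule.add_mem_sup (Ideal.mul_mem_left _ _ ha) ?_
      have e : superRadical 𝒜 ^ (n + 1 + 1) = superRadical 𝒜 ^ n * superRadical 𝒜 ^ 2 :=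
        Ideal.IsTwoSided.pow_add n 2
      rw [e]
      exact Ideal.mul_mem_mul hx hb
  obtain ⟨N, hN⟩ := exists_superRadical_pow_eq_bot 𝒜 h2
  refine (h N).trans (sup_le le_rfl ?_)
  rw [Ideal.IsTwoSided.pow_succ, hN]
  simp

/-- The `B`-basis of `J / J^2` given by odd coordinates. -/
def quotBasis : Module.Basis (Fin s) (evenQuotient 𝒜) (gr 𝒜 1) :=
  Module.Basis.mk hθ.linearIndependent_quot hθ.span_quot.ge

theorem exists_dual (i : Fin s) : ∃ D ∈ lieAlg 𝒜 1, ∀ j, counitHom 𝒜 (D (θ j)) =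
    if i = j then 1 else 0 := by
  refine ⟨_, (isOddPointDerivation (hθ.quotBasis.coord i)).mem_lieAlg, fun j => ?_⟩
  have e : oddPow 𝒜 (θ j) = ⟨θ j, odd_mem_pow_one 𝒜 (hθ.odd j)⟩ :=
    Subtype.ext (oddPart_of_odd 𝒜 (hθ.odd j))
  have e' : grMk 𝒜 1 ⟨θ j, odd_mem_pow_one 𝒜 (hθ.odd j)⟩ = hθ.quotBasis j := by
    rw [quotBasis, Module.Basis.mk_apply]
  rw [counitHom_invariantDerivation, pointDerivation_apply, e, e', Module.Basis.coord_apply,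
    Module.Basis.repr_self, Finsupp.single_apply]
  simp only [eq_comm (a := j)]
  split_ifs <;> simp

theorem evalLie_injective (h2 : (2 : k) ≠ 0) : Function.Injective (evalLie 𝒜 θ) := by
  rw [injective_iff_map_eq_zero]
  rintro ⟨D, hD⟩ h
  apply Subtype.ext
  refine lieAlg_one_eq_zero hD fun a => ?_
  obtain ⟨a, ha, b, hb, rfl⟩ := even_add_odd 𝒜 a
  rw [map_add, map_add, counitHom_lieAlg_one_of_even hD ha, zero_add]
  have hb' := hθ.superRadical_le h2 (odd_mem 𝒜 hb)
  clear hb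
  induction hb' using Submodule.span_induction with
  | mem x hx =>
    obtain ⟨i, rfl⟩ := hx
    exact congr_fun h i
  | zero => rw [map_zero, map_zero]
  | add x y _ _ hx hy => rw [map_add, map_add, hx, hy, add_zero]
  | smul c x hx' hx =>
    have hx0 : counitHom 𝒜 x = 0 := counitHom_rad 𝒜 ((Ideal.span_le.2 (by
      rintro _ ⟨i, rfl⟩
      exact odd_mem 𝒜 (hθ.odd i))) hx')
    rw [smul_eq_mul, lieAlg_one_mul hD, map_add, map_mul, map_mul, hx, hx0, mul_zero, mul_zero,
      add_zero]

theorem evalLie_surjective : Function.Surjective (evalLie 𝒜 θ) := by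
  intro c
  choose D hD hDθ using hθ.exists_dual
  refine ⟨∑ i, c i • ⟨D i, hD i⟩, ?_⟩
  ext j
  have e : ∀ i, evalLie 𝒜 θ ⟨D i, hD i⟩ j = if i = j then 1 else 0 := fun i => hDθ i j
  rw [map_sum, Finset.sum_apply]
  simp only [map_smul, Pi.smul_apply, e]
  simp

theorem finite_lieAlg (h2 : (2 : k) ≠ 0) : Module.Finite k (lieAlg 𝒜 1) :=
  Module.Finite.of_injective _ (hθ.evalLie_injective h2)

theorem finrank_lieAlg (h2 : (2 : k) ≠ 0) : Module.finrank k (lieAlg 𝒜 1) = s := by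
  rw [(LinearEquiv.ofBijective _ ⟨hθ.evalLie_injective h2, hθ.evalLie_surjective⟩).finrank_eq,
    Module.finrank_fin_fun]

end IsOddCoordinates

end

section

variable {k A : Type*} [Field k] [Ring A] [Algebra k A] [Coalgebra k A]
variable {𝒜 : ZMod 2 → Submodule k A} [GradedAlgebra 𝒜] [IsSuperAffineHopfAlgebra 𝒜]

section Augmentation

/-- The augmentation ideal of `A`. -/
abbrev augIdeal (𝒜 : ZMod 2 → Submodule k A) [GradedAlgebra 𝒜] [IsSuperAffineHopfAlgebra 𝒜] :
    Ideal A := RingHom.ker (counitHom 𝒜)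

theorem superRadical_le_augIdeal : superRadical 𝒜 ≤ augIdeal 𝒜 := fun _ ha => counitHom_rad 𝒜 ha

theorem parity_mem_augIdeal {a : A} (ha : a ∈ augIdeal 𝒜) : parity 𝒜 a ∈ augIdeal 𝒜 :=
  (counitHom_parity 𝒜 a).trans ha

theorem lieAlg_augIdeal_pow {D : Module.End k A} (hD : D ∈ lieAlg 𝒜 1) (n : ℕ) {x : A}
    (hx : x ∈ augIdeal 𝒜 ^ (n + 1)) : D x ∈ augIdeal 𝒜 ^ n := by
  induction n generalizing x with
  | zero => rw [Submodule.pow_zero, Ideal.one_eq_top]; trivial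
  | succ n ih =>
    rw [Ideal.IsTwoSided.pow_succ] at hx
    induction hx using Submodule.smul_induction_on' with
    | smul a ha b hb =>
      rw [smul_eq_mul, lieAlg_one_mul hD]
      refine Ideal.add_mem _ (Ideal.mul_mem_left _ _ hb) ?_
      rw [Ideal.IsTwoSided.pow_succ]
      exact Ideal.mul_mem_mul (parity_mem_augIdeal ha) (ih hb)
    | add x _ y _ hx hy => rw [map_add]; exact Ideal.add_mem _ hx hy

theorem lieAlg_prod_mem {s : ℕ} {θ : Fin s → A} (hθ : ∀ i, θ i ∈ 𝒜 1) {D : Module.End k A}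
    (hD : D ∈ lieAlg 𝒜 1) {l : List (Fin s)} (hl : ∀ i ∈ l, D (θ i) ∈ augIdeal 𝒜) :
    D (l.map θ).prod ∈ augIdeal 𝒜 ^ l.length := by
  induction l with
  | nil => rw [List.length_nil, Submodule.pow_zero, Ideal.one_eq_top]; trivial
  | cons i l ih =>
    have hm : ∀ i, θ i ∈ augIdeal 𝒜 := fun i => counitHom_odd 𝒜 (hθ i)
    rw [List.map_cons, List.prod_cons, List.length_cons, lieAlg_one_mul hD,
      Ideal.IsTwoSided.pow_succ]
    exact Ideal.add_mem _ (Ideal.mul_mem_mul (hl i List.mem_cons_self) (prod_mem_pow hm l))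
      (Ideal.mul_mem_mul (parity_mem_augIdeal (hm i))
        (ih fun j hj => hl j (List.mem_cons_of_mem _ hj)))

end Augmentation

namespace IsOddCoordinates

variable {s : ℕ} {θ : Fin s → A} (hθ : IsOddCoordinates 𝒜 θ)

include hθ

theorem prod_notMem {l : List (Fin s)} (hl : l.Nodup) :
    (l.map θ).prod ∉ augIdeal 𝒜 ^ (l.length + 1) := by
  induction l with
  | nil =>
    rw [List.length_nil, zero_add, Submodule.pow_one, List.map_nil, List.prod_nil,
      RingHom.mem_ker, map_one]
    exact one_ne_zero
  | cons i l ih =>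
    rw [List.nodup_cons] at hl
    intro h
    apply ih hl.2
    obtain ⟨D, hD, hDθ⟩ := hθ.exists_dual i
    have hm : ∀ i, θ i ∈ augIdeal 𝒜 := fun i => counitHom_odd 𝒜 (hθ.odd i)
    have e := lieAlg_augIdeal_pow hD _ h
    rw [List.map_cons, List.prod_cons, lieAlg_one_mul hD, List.length_cons] at e
    have e1 : parity 𝒜 (θ i) * D (l.map θ).prod ∈ augIdeal 𝒜 ^ (l.length + 1) := by
      rw [Ideal.IsTwoSided.pow_succ]
      refine Ideal.mul_mem_mul (parity_mem_augIdeal (hm i))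
        (lieAlg_prod_mem hθ.odd hD fun j hj => ?_)
      rw [RingHom.mem_ker]
      refine (hDθ j).trans (if_neg ?_)
      rintro rfl
      exact hl.1 hj
    have e2 : (D (θ i) - 1) * (l.map θ).prod ∈ augIdeal 𝒜 ^ (l.length + 1) := by
      rw [Ideal.IsTwoSided.pow_succ]
      refine Ideal.mul_mem_mul ?_ (prod_mem_pow hm l)
      rw [RingHom.mem_ker, map_sub, map_one]
      have := hDθ i
      rw [if_pos rfl] at this
      exact sub_eq_zero.2 this
    have e3 := Ideal.sub_mem _ (Ideal.sub_mem _ e e1) e2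
    rwa [add_sub_cancel_right, sub_mul, one_mul, sub_sub_cancel] at e3

theorem monomial_mem (I : Finset (Fin s)) : monomial θ I ∈ superRadical 𝒜 ^ I.card :=
  monomial_mem_pow (fun i => odd_mem 𝒜 (hθ.odd i)) I

theorem monomial_invariant (I : Finset (Fin s)) : monomial θ I ∈ invariants 𝒜 :=
  Subalgebra.list_prod_mem _ fun x hx => by
    obtain ⟨i, -, rfl⟩ := List.mem_map.1 hx
    exact hθ.invariant i

theorem coeff_eq_zero (h2 : (2 : k) ≠ 0) {n : ℕ} (c : Finset (Fin s) → k)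
    (hc : ∑ K, c K • monomial θ K ∈ superRadical 𝒜 ^ (n + 1)) {I : Finset (Fin s)}
    (hI : I.card ≤ n) : c I = 0 := by
  induction hp : I.card using Nat.strong_induction_on generalizing I with
  | _ p ih =>
  subst hp
  by_contra h0
  have hanti := isAnticommuting_of_odd 𝒜 h2 hθ.odd
  have hmul : ∀ K, K ≠ I → c K • (monomial θ K * monomial θ Iᶜ) = 0 := by
    intro K hK
    by_cases hKI : K ⊆ I
    · have hlt : K.card < I.card := Finset.card_lt_card (hKI.ssubset_of_ne hK)
      rw [ih _ hlt (hlt.le.trans hI) rfl, zero_smul]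
    · obtain ⟨i, hi, hi'⟩ := Finset.not_subset.1 hKI
      rw [monomial, monomial, ← List.prod_append, ← List.map_append, hanti.prod_eq_zero, smul_zero]
      rw [List.nodup_append']
      intro h
      exact h.2.2 (by simpa using hi) (by simpa using hi')
  have hmem : (∑ K, c K • monomial θ K) * monomial θ Iᶜ ∈ augIdeal 𝒜 ^ (s + 1) := by
    have h := Ideal.mul_mem_mul hc (hθ.monomial_mem Iᶜ)
    rw [← Ideal.IsTwoSided.pow_add] at h
    refine Ideal.pow_right_mono superRadical_le_augIdeal _ (Ideal.pow_le_pow_right ?_ h)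
    have := Finset.card_add_card_compl I
    rw [Fintype.card_fin] at this
    omega
  rw [Finset.sum_mul] at hmem
  simp only [smul_mul_assoc] at hmem
  rw [Finset.sum_eq_single I (fun K _ hK => hmul K hK) (by simp)] at hmem
  have hnd : (I.sort ++ (Iᶜ).sort).Nodup := by
    rw [List.nodup_append']
    refine ⟨Finset.sort_nodup .., Finset.sort_nodup .., fun i hi hi' => ?_⟩
    simp at hi hi'
    exact hi' hi
  refine hθ.prod_notMem hnd ?_
  have hlen : (I.sort ++ (Iᶜ).sort).length = s := by
    rw [List.length_append, Finset.length_sort, Finset.length_sort, Finset.card_add_card_compl,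
      Fintype.card_fin]
  rw [hlen, List.map_append, List.prod_append]
  have h := Ideal.mul_mem_left _ (algebraMap k A (c I)⁻¹) hmem
  rwa [← Algebra.smul_def, smul_smul, inv_mul_cancel₀ h0, one_smul] at h

theorem linearIndependent_monomial (h2 : (2 : k) ≠ 0) : LinearIndependent k (monomial θ) := by
  rw [Fintype.linearIndependent_iff]
  intro c hc I
  exact hθ.coeff_eq_zero h2 (n := I.card) c (by rw [hc]; exact Ideal.zero_mem _) le_rfl

/-- The monomials of degree `n`, as elements of `J^n`. -/
def powMonomial (n : ℕ) (I : {I : Finset (Fin s) // I.card = n}) : ↥(superRadical 𝒜 ^ n) :=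
  ⟨monomial θ I, (congrArg (superRadical 𝒜 ^ ·) I.2).le (hθ.monomial_mem I)⟩

theorem coe_powMonomial (n : ℕ) (I : {I : Finset (Fin s) // I.card = n}) :
    (hθ.powMonomial n I : A) = monomial θ I := rfl

/-- The classes in `J^n / J^(n+1)` of the monomials of degree `n`. -/
def grMonomial (n : ℕ) (I : {I : Finset (Fin s) // I.card = n}) : gr 𝒜 n :=
  grMk 𝒜 n (hθ.powMonomial n I)

theorem grMonomial_mem (n : ℕ) (I : {I : Finset (Fin s) // I.card = n}) :
    hθ.grMonomial n I ∈ grInvariants 𝒜 n :=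
  grMk_mem_grInvariants 𝒜 _ (hθ.monomial_invariant I)

theorem linearIndependent_grMonomial (h2 : (2 : k) ≠ 0) (n : ℕ) :
    LinearIndependent k (hθ.grMonomial n) := by
  classical
  rw [Fintype.linearIndependent_iff]
  intro c hc I
  let c' : Finset (Fin s) → k := fun K => if h : K.card = n then c ⟨K, h⟩ else 0
  have hsum : ∑ K, c' K • monomial θ K =
      ∑ K : {K : Finset (Fin s) // K.card = n}, c K • monomial θ K := by
    have h0 : ∀ K ∈ Finset.univ, K ∉ Finset.univ.filter (fun K : Finset (Fin s) => K.card = n) →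
        c' K • monomial θ K = 0 := by
      intro K _ hK
      have hK' : ¬ K.card = n := by simpa using hK
      rw [show c' K = 0 from dif_neg hK', zero_smul]
    rw [← Finset.sum_subset (Finset.subset_univ _) h0,
      Finset.sum_subtype (p := fun K => K.card = n) _ (by simp)]
    refine Finset.sum_congr rfl fun K _ => ?_
    rw [show c' K = c K from dif_pos K.2]
  have e : c' I = 0 := by
    refine hθ.coeff_eq_zero h2 (n := n) c' ?_ I.2.le
    rw [hsum]
    have hc' : grMk 𝒜 n (∑ K : {K : Finset (Fin s) // K.card = n},
        c K • hθ.powMonomial n K) = 0 := by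
      rw [← hc, map_sum]
      rfl
    have h := Submodule.mem_comap.1 ((Submodule.Quotient.mk_eq_zero _).1 hc')
    simpa [coe_powMonomial] using h
  simpa [c', I.2] using e

theorem span_grMonomial (h2 : (2 : k) ≠ 0) (n : ℕ) :
    Submodule.span (evenQuotient 𝒜) (Set.range (hθ.grMonomial n)) = ⊤ := by
  refine span_grMk_eq_top 𝒜 (hθ.powMonomial n) ?_
  refine ((isAnticommuting_of_odd 𝒜 h2 hθ.odd).pow_le_span
    (fun i c => ⟨_, odd_mul_comm 𝒜 (hθ.odd i) c⟩) (hθ.superRadical_le h2) n).trans ?_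
  refine Ideal.span_mono ?_
  rintro _ ⟨I, hI, rfl⟩
  exact ⟨⟨I, hI⟩, rfl⟩

/-- The `B`-basis of `J^n / J^(n+1)` given by the monomials of degree `n`. -/
def grBasis (h2 : (2 : k) ≠ 0) (n : ℕ) :
    Module.Basis {I : Finset (Fin s) // I.card = n} (evenQuotient 𝒜) (gr 𝒜 n) :=
  Module.Basis.mk ((isHopfModule_gr 𝒜 n).linearIndependent (hθ.grMonomial_mem n)
    (hθ.linearIndependent_grMonomial h2 n)) (hθ.span_grMonomial h2 n).ge

theorem grInvariants_le_span (h2 : (2 : k) ≠ 0) (n : ℕ) {v : gr 𝒜 n}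
    (hv : v ∈ grInvariants 𝒜 n) : v ∈ Submodule.span k (Set.range (hθ.grMonomial n)) := by
  have h : v ∈ Submodule.span (evenQuotient 𝒜) (Set.range (hθ.grMonomial n)) := by
    rw [hθ.span_grMonomial h2]
    trivial
  obtain ⟨b, hb⟩ := (Submodule.mem_span_range_iff_exists_fun _).1 h
  have e := IsHopfModule.average_of_invariant hv
  rw [← e, ← hb, map_sum]
  refine Submodule.sum_mem _ fun I _ => ?_
  rw [(isHopfModule_gr 𝒜 n).average_smul,
    IsHopfModule.average_of_invariant (hθ.grMonomial_mem n I)]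
  exact Submodule.smul_mem _ _ (Submodule.subset_span ⟨I, rfl⟩)

theorem exists_sub_mem_pow_succ (h2 : (2 : k) ≠ 0) {n : ℕ} {a : A} (ha : a ∈ invariants 𝒜)
    (hn : a ∈ superRadical 𝒜 ^ n) : ∃ x ∈ Submodule.span k (Set.range (monomial θ)),
      a - x ∈ superRadical 𝒜 ^ (n + 1) := by
  obtain ⟨c, hc⟩ := (Submodule.mem_span_range_iff_exists_fun k).1
    (hθ.grInvariants_le_span h2 n (grMk_mem_grInvariants 𝒜 ⟨a, hn⟩ ha))
  refine ⟨∑ I : {I : Finset (Fin s) // I.card = n}, c I • monomial θ I,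
    Submodule.sum_mem _ fun I _ => Submodule.smul_mem _ _ (Submodule.subset_span ⟨I, rfl⟩), ?_⟩
  have e : grMk 𝒜 n (⟨a, hn⟩ - ∑ I : {I : Finset (Fin s) // I.card = n},
      c I • hθ.powMonomial n I) = 0 := by
    rw [map_sub, ← hc, map_sum]
    exact sub_self _
  have h := Submodule.mem_comap.1 ((Submodule.Quotient.mk_eq_zero _).1 e)
  simpa [coe_powMonomial] using h

theorem span_monomial_le :
    Submodule.span k (Set.range (monomial θ)) ≤ (invariants 𝒜).toSubmodule := by
  rw [Submodule.span_le]
  rintro _ ⟨I, rfl⟩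
  exact hθ.monomial_invariant I

theorem span_monomial (h2 : (2 : k) ≠ 0) :
    Submodule.span k (Set.range (monomial θ)) = (invariants 𝒜).toSubmodule := by
  refine le_antisymm hθ.span_monomial_le fun a ha => ?_
  have h : ∀ n, ∃ x ∈ Submodule.span k (Set.range (monomial θ)), a - x ∈ superRadical 𝒜 ^ n := by
    intro n
    induction n with
    | zero =>
      refine ⟨0, Submodule.zero_mem _, ?_⟩
      rw [Submodule.pow_zero, Ideal.one_eq_top]
      trivial
    | succ n ih =>
      obtain ⟨x, hx, hax⟩ := ih
      obtain ⟨y, hy, hay⟩ := hθ.exists_sub_mem_pow_succ h2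
        (Subalgebra.sub_mem _ ha (hθ.span_monomial_le hx)) hax
      exact ⟨x + y, Submodule.add_mem _ hx hy, by rwa [← sub_sub]⟩
  obtain ⟨N, hN⟩ := exists_superRadical_pow_eq_bot 𝒜 h2
  obtain ⟨x, hx, hax⟩ := h N
  rw [hN, Submodule.mem_bot, sub_eq_zero] at hax
  rwa [hax]

theorem finrank_invariants (h2 : (2 : k) ≠ 0) : Module.finrank k (invariants 𝒜) = 2 ^ s := by
  have h := finrank_span_eq_card (hθ.linearIndependent_monomial h2)
  rw [hθ.span_monomial h2, Fintype.card_finset, Fintype.card_fin] at h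
  exact h

theorem exists_exteriorEquiv (h2 : (2 : k) ≠ 0) :
    ∃ e : ExteriorAlgebra k (Fin s → k) ≃ₐ[k] invariants 𝒜,
      ∀ i, (e (ExteriorAlgebra.ι k (Pi.single i 1)) : A) = θ i := by
  let g : (Fin s → k) →ₗ[k] invariants 𝒜 :=
    Fintype.linearCombination k fun i => ⟨θ i, hθ.invariant i⟩
  have hg : ∀ v, (g v : A) ∈ 𝒜 1 := by
    intro v
    rw [Fintype.linearCombination_apply, AddSubmonoidClass.coe_finsetSum]
    exact Submodule.sum_mem _ fun i _ => Submodule.smul_mem _ _ (hθ.odd i)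
  let f : ExteriorAlgebra k (Fin s → k) →ₐ[k] invariants 𝒜 :=
    ExteriorAlgebra.lift k ⟨g, fun v => Subtype.ext (odd_sq 𝒜 h2 (hg v))⟩
  let y : Fin s → ExteriorAlgebra k (Fin s → k) := fun i => ExteriorAlgebra.ι k (Pi.single i 1)
  have hf : ∀ i, (f (y i) : A) = θ i := by
    intro i
    simp [f, y, g, Fintype.linearCombination_apply_single]
  have hmon : ∀ I, (f (monomial y I) : A) = monomial θ I := by
    intro I
    rw [← Subalgebra.val_apply, ← AlgHom.comp_apply, map_monomial]
    exact congr_arg (monomial · I) (funext hf)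
  have hy : IsAnticommuting y := by
    refine ⟨fun i => ExteriorAlgebra.ι_sq_zero _, fun i j => ?_⟩
    rw [eq_neg_iff_add_eq_zero]
    exact ExteriorAlgebra.ι_add_mul_swap _ _
  have hspan : Submodule.span k (Set.range (monomial y)) = ⊤ := by
    apply hy.span_monomial_of_adjoin
    refine top_le_iff.1 (CliffordAlgebra.adjoin_range_ι.ge.trans (Algebra.adjoin_le ?_))
    rintro _ ⟨v, rfl⟩
    have hv : v = ∑ i, v i • Pi.single i (1 : k) := by
      ext j
      simp [Pi.single_apply]
    rw [hv, map_sum]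
    refine Subalgebra.sum_mem _ fun i _ => ?_
    rw [map_smul]
    have hi : y i ∈ Algebra.adjoin k (Set.range y) := Algebra.subset_adjoin (Set.mem_range_self i)
    exact Subalgebra.smul_mem _ hi _
  have hinj : Function.Injective f := by
    rw [injective_iff_map_eq_zero]
    intro x hx
    have hx' : x ∈ Submodule.span k (Set.range (monomial y)) := by
      rw [hspan]
      trivial
    obtain ⟨c, rfl⟩ := (Submodule.mem_span_range_iff_exists_fun k).1 hx'
    have e : ∑ I, c I • monomial θ I = 0 := by
      have := congr((invariants 𝒜).val $hx)
      rw [map_sum, map_sum, map_zero] at this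
      simpa [hmon] using this
    have := Fintype.linearIndependent_iff.1 (hθ.linearIndependent_monomial h2) c e
    simp [this]
  have hsurj : Function.Surjective f := by
    rintro ⟨a, ha⟩
    have ha' : a ∈ Submodule.span k (Set.range (monomial θ)) := by
      rw [hθ.span_monomial h2]
      exact ha
    obtain ⟨c, hc⟩ := (Submodule.mem_span_range_iff_exists_fun k).1 ha'
    refine ⟨∑ I, c I • monomial y I, Subtype.ext ?_⟩
    refine Eq.trans ?_ hc
    rw [map_sum, AddSubmonoidClass.coe_finsetSum]
    simp [hmon]
  exact ⟨AlgEquiv.ofBijective f ⟨hinj, hsurj⟩, hf⟩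

end IsOddCoordinates

end

end

end SuperHopf

open SuperHopf in
theorem lemma8 {k A : Type*} [Field k] (h2 : (2 : k) ≠ 0) [Ring A] [Algebra k A] [Coalgebra k A]
    (𝒜 : ZMod 2 → Submodule k A) [GradedAlgebra 𝒜] [IsSuperAffineHopfAlgebra 𝒜]
    (s : ℕ) (hs : s = Module.finrank k (lieAlg 𝒜 1)) :
    Module.Finite k (lieAlg 𝒜 1) ∧
    (∃ θ : Fin s → A, IsOddCoordinates 𝒜 θ) ∧
    (∀ θ : Fin s → A, IsOddCoordinates 𝒜 θ →
      ∃ e : ExteriorAlgebra k (Fin s → k) ≃ₐ[k] invariants 𝒜,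
        ∀ i, (e (ExteriorAlgebra.ι k (Pi.single i 1)) : A) = θ i) ∧
    (∀ n : ℕ, Module.Free (evenQuotient 𝒜) (gr 𝒜 n) ∧
      Module.Finite (evenQuotient 𝒜) (gr 𝒜 n) ∧
      Module.finrank (evenQuotient 𝒜) (gr 𝒜 n) = s.choose n) ∧
    Module.finrank k (invariants 𝒜) = 2 ^ s := by
  obtain ⟨r, θ, hθ⟩ := exists_isOddCoordinates 𝒜 h2
  obtain rfl : s = r := hs.trans (hθ.finrank_lieAlg h2)
  refine ⟨hθ.finite_lieAlg h2, ⟨θ, hθ⟩, fun θ' hθ' => hθ'.exists_exteriorEquiv h2, fun n => ?_,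
    hθ.finrank_invariants h2⟩
  refine ⟨Module.Free.of_basis (hθ.grBasis h2 n), Module.Finite.of_basis (hθ.grBasis h2 n), ?_⟩
  rw [Module.finrank_eq_card_basis (hθ.grBasis h2 n), Fintype.card_finset_len, Fintype.card_fin]
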